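/- Let $R>0$. For positive integers $k,d$ let $$\mathcal G_{k,d}=\Big\{\sum_{j=1}^k w_j\delta_{\mu_j}:\ \mu_j\in\mathbb R^d,\ \|\mu_j\|_2\le R,\ w_j\ge 0,\ \sum_{j=1}^k w_j=1\Big\},$$ and for $\Gamma\in\mathcal G_{k,d}$ let $P_\Gamma=\Gamma*N(0,I_d)$ be the corresponding Gaussian location mixture. Let $H(P,Q)=\big(\int(\sqrt p-\sqrt q)^2\,d\nu\big)^{1/2}$ be the Hellinger distance, where $p,q$ are the densities of $P,Q$ with respect to a common dominating measure $\nu$. For $\Gamma_0\in\mathcal G_{k,d}$ and $\epsilon>0$ put $$\mathcal P_\epsilon(\Gamma_0)=\{P_\Gamma:\ \Gamma\in\mathcal G_{k,d},\ H(P_\Gamma,P_{\Gamma_0})\le\epsilon\}.$$ For $\delta>0$ let $N(\delta,\mathcal P_\epsilon(\Gamma_0),H)$ be the minimum cardinality of a set $C\subseteq\mathcal P_\epsilon(\Gamma_0)$ such that every $P\in\mathcal P_\epsilon(\Gamma_0)$ satisfies $H(P,Q)<\delta$ for some $Q\in C$. Then there is a constant $c>0$ depending only on $R$ such that for all $k,d\ge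 1$, all $\Gamma_0\in\mathcal G_{k,d}$ and all $0<\delta\le\epsilon/2$, $$N(\delta,\mathcal P_\epsilon(\Gamma_0),H)\ \le\ \Big(\frac{\epsilon}{\delta}\Big)^{c\,(dk^4+(2k)^{2k+2})}.$$ -/

import Mathlib

open MeasureTheory ProbabilityTheory
open scoped NNReal ENNReal

noncomputable section

namespace GaussianMixture

/-- The class `𝒢_{k,d}` of `k`-atomic distributions `∑ j, w j • δ_{μ j}` on `ℝ^d` whose atoms lie
in the closed Euclidean ball of radius `R` about the origin. Atoms may coincide and weights may
vanish. -/
def mixingDistributions (R : ℝ) (k d : ℕ) : Set (Measure (EuclideanSpace ℝ (Fin d))) :=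
  {Γ | ∃ (w : Fin k → ℝ≥0) (μ : Fin k → EuclideanSpace ℝ (Fin d)),
    ∑ j, w j = 1 ∧ (∀ j, ‖μ j‖ ≤ R) ∧ Γ = ∑ j, w j • Measure.dirac (μ j)}

/-- The Gaussian location mixture `P_Γ = Γ * N(0, I_d)`. -/
def mixture {d : ℕ} (Γ : Measure (EuclideanSpace ℝ (Fin d))) :
    Measure (EuclideanSpace ℝ (Fin d)) :=
  Γ.conv (stdGaussian (EuclideanSpace ℝ (Fin d)))

/-- The Hellinger distance `H(P, Q) = (∫ (√p - √q)² dν)^{1/2}` of two finite measures, where `p`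
and `q` are the densities of `P` and `Q` with respect to the dominating measure `ν = P + Q`. -/
def hellinger {Ω : Type*} [MeasurableSpace Ω] (P Q : Measure Ω) : ℝ :=
  √(∫ x, (√(P.rnDeriv (P + Q) x).toReal - √(Q.rnDeriv (P + Q) x).toReal) ^ 2 ∂(P + Q))

/-- The covering number `N(δ, A, ρ)`: the least cardinality of a set `C` of points of `A` such that
every point of `A` is at `ρ`-distance less than `δ` from some point of `C`
(it is `⊤` if there is no finite such `C`). -/
def coveringNumber {X : Type*} (δ : ℝ) (A : Set X) (ρ : X → X → ℝ) : ℕ∞ :=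
  ⨅ (C : Set X) (_ : C ⊆ A) (_ : ∀ a ∈ A, ∃ b ∈ C, ρ a b < δ), C.encard

/-- The Hellinger neighbourhood
`𝒫_ε(Γ₀) = {P_Γ : Γ ∈ 𝒢_{k,d}, H(P_Γ, P_{Γ₀}) ≤ ε}`. -/
def hellingerBall (R : ℝ) (k d : ℕ) (ε : ℝ) (Γ₀ : Measure (EuclideanSpace ℝ (Fin d))) :
    Set (Measure (EuclideanSpace ℝ (Fin d))) :=
  {P | ∃ Γ ∈ mixingDistributions R k d, P = mixture Γ ∧ hellinger (mixture Γ) (mixture Γ₀) ≤ ε}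

end GaussianMixture

end

noncomputable section

namespace GaussianMixture

/-! ### Packing in finite-dimensional normed spaces -/

section Packing

variable {E : Type*} [NormedAddCommGroup E] [NormedSpace ℝ E] [FiniteDimensional ℝ E]

/-! Near the centre `Γ₀`, a mixture is determined up to Hellinger error by boundedly many
parameters, and these range over a set whose radius is proportional to `ε`. The covering number then
follows from volume packing in a finite-dimensional normed space. Hellinger controls moments:
expectations of square-integrable functions are Lipschitz in the Hellinger distance. Testing with
complex exponentials bounds the Laplace transform of `Γ - Γ₀`, and Cauchy's estimates bound its
moments of order `l` along complex directions by a multiple of `l! ε` (`norm_moment_le_hellinger`).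
Moments control Hellinger: a difference of two mixing measures has at most `2k` atoms, so its first
`2k` moments along any direction control all the others, with no separation of atoms needed
(`norm_sum_mul_pow_le`). They therefore control its Laplace transform, and a weighted `L²` distance
of densities turns this into a Hellinger bound with a constant free of `d` (`hellinger_le_moment`).
The parameters of `P_Γ` are a frame of `2k` vectors spanning the atoms of `Γ` and `Γ₀`, and the
moments of `Γ - Γ₀` in the coordinates of that frame. They lie in a space of dimension at most `2kd
+ (2k)^(2k)`. Since the moments are already of size `ε`, Schwarz's lemma shows that changing the
frame by `h` costs only order `ε h` (`norm_moment_sub_moment_le`). Hence the frame is needed only at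
scale `δ/ε`, and the cover depends on `ε/δ` rather than on `1/δ`. The base constants are
`exp(O(k²))`, which accounts for the extra `k²` in the exponent. -/

theorem card_le_of_separated (s : Finset E) {B η : ℝ} (hη : 0 < η) (hB : 0 ≤ B)
    (hs : ∀ c ∈ s, ‖c‖ ≤ B) (h : ∀ c ∈ s, ∀ d ∈ s, c ≠ d → η ≤ ‖c - d‖) :
    (s.card : ℝ) ≤ (1 + 2 * B / η) ^ Module.finrank ℝ E := by
  borelize E
  let μ : Measure E := Measure.addHaar
  have hη2 : 0 < η / 2 := half_pos hη
  have ρpos : 0 < B + η / 2 := by positivity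
  have D : Set.Pairwise (s : Set E)
      (Function.onFun Disjoint fun c => Metric.ball (c : E) (η / 2)) := by
    rintro c hc d hd hcd
    apply Metric.ball_disjoint_ball
    rw [dist_eq_norm, add_halves]
    exact h c hc d hd hcd
  -- Volume comparison: the half-radius balls are disjoint and fit inside one slightly enlarged
  -- ball.
  have A_subset : (⋃ c ∈ s, Metric.ball (c : E) (η / 2)) ⊆ Metric.ball (0 : E) (B + η / 2) := by
    refine Set.iUnion₂_subset fun x hx => ?_
    apply Metric.ball_subset_ball'
    rw [dist_zero_right]
    linarith [hs x hx]
  have I : (s.card : ℝ≥0∞) * ENNReal.ofReal ((η / 2) ^ Module.finrank ℝ E) * μ (Metric.ball 0 1) ≤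
      ENNReal.ofReal ((B + η / 2) ^ Module.finrank ℝ E) * μ (Metric.ball 0 1) :=
    calc
      _ = μ (⋃ c ∈ s, Metric.ball (c : E) (η / 2)) := by
        rw [measure_biUnion_finset D fun c _ => measurableSet_ball]
        simp only [μ.addHaar_ball_of_pos _ hη2, Finset.sum_const, nsmul_eq_mul, mul_assoc]
      _ ≤ μ (Metric.ball (0 : E) (B + η / 2)) := measure_mono A_subset
      _ = _ := by simp only [μ.addHaar_ball_of_pos _ ρpos]
  have J := (ENNReal.mul_le_mul_iff_left
    (Metric.measure_ball_pos μ (0 : E) zero_lt_one).ne' measure_ball_lt_top.ne).1 I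
  have K := ENNReal.toReal_le_of_le_ofReal (pow_nonneg ρpos.le _) J
  rw [ENNReal.toReal_mul, ENNReal.toReal_natCast, ENNReal.toReal_ofReal (by positivity)] at K
  have : 1 + 2 * B / η = (B + η / 2) / (η / 2) := by field_simp; ring
  rw [this, div_pow, le_div_iff₀ (by positivity)]
  exact K

/-- A separated family of largest cardinality is automatically a cover. Separation is measured after
`Φ` but centres are chosen in `A` itself, so the cover is internal and nothing is required of `Φ`
beyond boundedness on `A`. -/
theorem exists_finset_cover {α : Type*} (A : Set α) (Φ : α → E) {B η : ℝ} (hη : 0 < η)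
    (hB : 0 ≤ B) (hΦ : ∀ a ∈ A, ‖Φ a‖ ≤ B) :
    ∃ C : Finset α, (C : Set α) ⊆ A ∧ (C.card : ℝ) ≤ (1 + 2 * B / η) ^ Module.finrank ℝ E ∧
      ∀ a ∈ A, ∃ b ∈ C, ‖Φ a - Φ b‖ < η := by
  classical
  let good : Finset α → Prop := fun C =>
    (C : Set α) ⊆ A ∧ ∀ c ∈ C, ∀ d ∈ C, c ≠ d → η ≤ ‖Φ c - Φ d‖
  have hcard : ∀ C, good C → (C.card : ℝ) ≤ (1 + 2 * B / η) ^ Module.finrank ℝ E := by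
    rintro C ⟨hCA, hC⟩
    have hinj : Set.InjOn Φ C := by
      intro c hc d hd hcd
      by_contra hne
      have := hC c hc d hd hne
      rw [hcd, sub_self, norm_zero] at this
      linarith
    rw [← Finset.card_image_of_injOn hinj]
    apply card_le_of_separated _ hη hB
    · intro c hc
      obtain ⟨a, ha, rfl⟩ := Finset.mem_image.1 hc
      exact hΦ a (hCA ha)
    · intro c hc d hd hcd
      obtain ⟨a, ha, rfl⟩ := Finset.mem_image.1 hc
      obtain ⟨b, hb, rfl⟩ := Finset.mem_image.1 hd
      exact hC a ha b hb (fun h => hcd (h ▸ rfl))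
  let S : Set ℕ := {m | ∃ C, good C ∧ C.card = m}
  have hSne : S.Nonempty := ⟨0, ∅, ⟨by simp, by simp⟩, rfl⟩
  have hSb : BddAbove S := by
    refine ⟨⌊(1 + 2 * B / η) ^ Module.finrank ℝ E⌋₊, ?_⟩
    rintro m ⟨C, hC, rfl⟩
    exact Nat.le_floor (hcard C hC)
  obtain ⟨C, hC, hCm⟩ := Nat.sSup_mem hSne hSb
  refine ⟨C, hC.1, hcard C hC, fun a ha => ?_⟩
  by_contra! hcon
  have haC : a ∉ C := fun h => by
    have := hcon a h
    rw [sub_self, norm_zero] at this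
    linarith
  have hgood : good (insert a C) := by
    refine ⟨?_, ?_⟩
    · rw [Finset.coe_insert]
      exact Set.insert_subset ha hC.1
    · intro c hc d hd hcd
      rcases Finset.mem_insert.1 hc with rfl | hc' <;> rcases Finset.mem_insert.1 hd with rfl | hd'
      · exact absurd rfl hcd
      · exact hcon d hd'
      · rw [norm_sub_rev]; exact hcon c hc'
      · exact hC.2 c hc' d hd' hcd
  have := le_csSup hSb ⟨_, hgood, rfl⟩
  rw [Finset.card_insert_of_notMem haC, ← hCm] at this
  omega

end Packing

/-! ### Moments of finitely supported complex measures on `ℂ` -/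

section Moments

variable {ι : Type*}

/-- Multiplying the weights by `l i - l i₀` removes the atom `i₀` and replaces the moment `m_j` by
`m_{j+1} - l i₀ m_j`. Induction on the number of atoms bounds these differences, and the recursion
then bounds the moments. No Vandermonde matrix is inverted, so atoms may collide and weights may
have any sign. -/
theorem norm_sum_mul_pow_le (s : Finset ι) (a l : ι → ℂ) {M ρ : ℝ} (hM : 0 ≤ M) (hρ : 0 ≤ ρ)
    (hl : ∀ i ∈ s, ‖l i‖ ≤ ρ) (hm : ∀ j < s.card, ‖∑ i ∈ s, a i * l i ^ j‖ ≤ M) (j : ℕ) :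
    ‖∑ i ∈ s, a i * l i ^ j‖ ≤ (1 + 2 * ρ) ^ j * M := by
  classical
  induction s using Finset.induction_on generalizing a M j with
  | empty => simp; positivity
  | insert i₀ s hi₀ ih =>
    rw [Finset.card_insert_of_notMem hi₀] at hm
    have key : ∀ j, ∑ i ∈ s, (a i * (l i - l i₀)) * l i ^ j =
        ∑ i ∈ insert i₀ s, a i * l i ^ (j + 1) - l i₀ * ∑ i ∈ insert i₀ s, a i * l i ^ j := by
      intro j
      rw [Finset.sum_insert hi₀, Finset.sum_insert hi₀, mul_add, Finset.mul_sum,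
        add_sub_add_comm, ← Finset.sum_sub_distrib, pow_succ]
      rw [show a i₀ * (l i₀ ^ j * l i₀) - l i₀ * (a i₀ * l i₀ ^ j) = 0 by ring, zero_add]
      exact Finset.sum_congr rfl fun i _ => by ring
    have hl₀ := hl i₀ (Finset.mem_insert_self _ _)
    have ih' := ih (fun i => a i * (l i - l i₀)) (M := (1 + ρ) * M) (by positivity)
      (fun i hi => hl i (Finset.mem_insert_of_mem hi)) (fun j hj => by
        rw [key]
        refine (norm_sub_le _ _).trans ?_
        rw [norm_mul, add_mul, one_mul]
        have h1 := hm j (by omega)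
        gcongr
        exact hm _ (by omega))
    induction j with
    | zero => simpa using hm 0 (by omega)
    | succ j ihj =>
      have h := ih' j
      rw [key] at h
      have h2 : ‖∑ i ∈ insert i₀ s, a i * l i ^ (j + 1)‖ ≤
          ‖∑ i ∈ insert i₀ s, a i * l i ^ (j + 1) - l i₀ * ∑ i ∈ insert i₀ s, a i * l i ^ j‖
          + ‖l i₀ * ∑ i ∈ insert i₀ s, a i * l i ^ j‖ := norm_le_norm_sub_add _ _
      have h3 : ‖l i₀ * ∑ i ∈ insert i₀ s, a i * l i ^ j‖ ≤ ρ * ((1 + 2 * ρ) ^ j * M) := by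
        rw [norm_mul]; gcongr
      calc _ ≤ (1 + 2 * ρ) ^ j * ((1 + ρ) * M) + ρ * ((1 + 2 * ρ) ^ j * M) := by linarith
        _ = _ := by ring

variable [Fintype ι]

/-- The exponential series, estimated term by term through the moment bound. -/
theorem norm_sum_mul_exp_le (a l : ι → ℂ) {M ρ r : ℝ} (hM : 0 ≤ M) (hρ : 0 ≤ ρ) (hr : 0 ≤ r)
    (hl : ∀ i, ‖l i‖ ≤ ρ) (hm : ∀ j < Fintype.card ι, ‖∑ i, a i * l i ^ j‖ ≤ M) :
    ‖∑ i, a i * Complex.exp (r * l i)‖ ≤ M * Real.exp ((1 + 2 * ρ) * r) := by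
  have h1 : HasSum (fun j : ℕ => ∑ i, a i * ((r * l i) ^ j / (j.factorial : ℂ)))
      (∑ i, a i * Complex.exp (r * l i)) := by
    refine hasSum_sum fun i _ => HasSum.mul_left _ ?_
    rw [Complex.exp_eq_exp_ℂ]
    exact NormedSpace.expSeries_div_hasSum_exp _
  have h2 : HasSum (fun j : ℕ => M * (((1 + 2 * ρ) * r) ^ j / (j.factorial : ℝ)))
      (M * Real.exp ((1 + 2 * ρ) * r)) := by
    refine HasSum.mul_left _ ?_
    rw [Real.exp_eq_exp_ℝ]
    exact NormedSpace.expSeries_div_hasSum_exp _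
  rw [← h1.tsum_eq]
  refine tsum_of_norm_bounded h2 fun j => ?_
  have : ∑ i, a i * ((r * l i) ^ j / (j.factorial : ℂ)) =
      ((r ^ j / j.factorial : ℝ) : ℂ) * ∑ i, a i * l i ^ j := by
    rw [Finset.mul_sum]
    refine Finset.sum_congr rfl fun i _ => ?_
    push_cast
    rw [mul_pow]; ring
  rw [this, norm_mul, Complex.norm_real, Real.norm_of_nonneg (by positivity)]
  have := norm_sum_mul_pow_le Finset.univ a l hM hρ (fun i _ => hl i) hm j
  calc _ ≤ r ^ j / j.factorial * ((1 + 2 * ρ) ^ j * M) := by gcongr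
    _ = _ := by rw [mul_pow]; ring

/-- The moments are the derivatives at `0` of an entire exponential sum, so Cauchy's estimate on the
unit circle applies. -/
theorem norm_sum_mul_pow_le_factorial (a l : ι → ℂ) {C : ℝ}
    (h : ∀ z : ℂ, ‖z‖ = 1 → ‖∑ i, a i * Complex.exp (l i * z)‖ ≤ C) (j : ℕ) :
    ‖∑ i, a i * l i ^ j‖ ≤ j.factorial * C := by
  have hd : Differentiable ℂ (fun z : ℂ => ∑ i, a i * Complex.exp (l i * z)) := by fun_prop
  have := Complex.norm_iteratedDeriv_le_of_forall_mem_sphere_norm_le (c := 0) (R := 1) (C := C)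
    (f := fun z : ℂ => ∑ i, a i * Complex.exp (l i * z)) j one_pos
    hd.diffContOnCl (fun z hz => h z (by simpa using hz))
  have hder : iteratedDeriv j (fun z : ℂ => ∑ i, a i * Complex.exp (l i * z)) 0 =
      ∑ i, a i * l i ^ j := by
    rw [iteratedDeriv_fun_sum (fun i _ => by fun_prop)]
    refine Finset.sum_congr rfl fun i _ => ?_
    rw [iteratedDeriv_const_mul_field, iteratedDeriv_cexp_const_mul]
    simp
  rw [hder] at this
  simpa using this

/-- Schwarz's lemma for the polynomial in `τ` on the disc of radius `3`, which contains every `h ≤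
2`. The bound keeps the factor `B`, so a small moment function also varies little. -/
theorem norm_sum_mul_add_pow_sub_le (a α β : ι → ℂ) (j : ℕ) {B h : ℝ} (hB : 0 < B) (h0 : 0 ≤ h)
    (h2 : h ≤ 2) (hb : ∀ τ : ℂ, ‖τ‖ ≤ 3 → ‖∑ i, a i * (α i + τ * β i) ^ j‖ ≤ B) :
    ‖∑ i, a i * (α i + h * β i) ^ j - ∑ i, a i * α i ^ j‖ ≤ B * h := by
  let f : ℂ → ℂ := fun τ => ∑ i, a i * (α i + τ * β i) ^ j
  have hd : Differentiable ℂ f := by fun_prop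
  have hf0 : f 0 = ∑ i, a i * α i ^ j := by simp [f]
  have hmaps : Set.MapsTo f (Metric.ball 0 3) (Metric.closedBall (f 0) (3 * B)) := by
    intro τ hτ
    rw [mem_ball_iff_norm] at hτ
    rw [mem_closedBall_iff_norm]
    have h1 := hb τ (by simpa using hτ.le)
    have h2 := hb 0 (by simp)
    have := norm_sub_le (f τ) (f 0)
    calc _ ≤ B + B := this.trans (add_le_add h1 h2)
      _ ≤ 3 * B := by linarith
  have := Complex.dist_le_div_mul_dist_of_mapsTo_ball (z := (h : ℂ)) hd.differentiableOn hmaps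
    (show (h : ℂ) ∈ Metric.ball 0 3 by
      rw [mem_ball_iff_norm, sub_zero, Complex.norm_real, Real.norm_of_nonneg h0]; linarith)
  rw [dist_eq_norm, dist_eq_norm, sub_zero, Complex.norm_real, Real.norm_of_nonneg h0, hf0] at this
  calc _ ≤ 3 * B / 3 * h := this
    _ = B * h := by ring

end Moments

/-! ### Frames -/

section Frame

open scoped InnerProductSpace

variable {E : Type*} [NormedAddCommGroup E] [InnerProductSpace ℝ E]

/-- The synthesis map `s ↦ ∑ j, s j • b j` of a finite family `b`. -/
def synthesis {n : ℕ} (b : Fin n → E) (s : EuclideanSpace ℝ (Fin n)) : E := ∑ j, s j • b j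

/-- The analysis map `t ↦ (⟪b j, t⟫)_j` of a finite family `b`. -/
def analysis {n : ℕ} (b : Fin n → E) (t : E) : EuclideanSpace ℝ (Fin n) :=
  WithLp.toLp 2 fun j => ⟪b j, t⟫_ℝ

theorem inner_synthesis {n : ℕ} (b : Fin n → E) (s : EuclideanSpace ℝ (Fin n)) (x : E) :
    ⟪x, synthesis b s⟫_ℝ = ∑ j, s j * ⟪x, b j⟫_ℝ := by
  simp [synthesis, inner_sum, inner_smul_right]

theorem inner_analysis {n : ℕ} (b : Fin n → E) (s : EuclideanSpace ℝ (Fin n)) (x : E) :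
    ⟪analysis b x, s⟫_ℝ = ⟪x, synthesis b s⟫_ℝ := by
  rw [inner_synthesis]
  simp [analysis, PiLp.inner_apply, real_inner_comm]

theorem sum_eq_sum_comp_of_injective {m n : ℕ} {F : Type*} [AddCommMonoid F] {e : Fin m → Fin n}
    (he : Function.Injective e) (f : Fin n → F) (hf : ∀ j, j ∉ Set.range e → f j = 0) :
    ∑ j, f j = ∑ i, f (e i) := by
  symm
  refine Finset.sum_of_injOn e he.injOn (by simp) (fun j _ hj => hf j ?_) (by simp)
  simpa using hj

/-- Any family of at most `n` vectors lies in the span of a family of `n` vectors whose nonzero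
members are orthonormal. -/
theorem exists_frame {ι : Type*} [Fintype ι] {n : ℕ} (hn : Fintype.card ι ≤ n) (x : ι → E) :
    ∃ b : Fin n → E, (∀ j, ‖b j‖ ≤ 1) ∧ (∀ t, ‖analysis b t‖ ≤ ‖t‖) ∧
      (∀ s, ‖synthesis b s‖ ≤ ‖s‖) ∧ ∀ i t, ⟪x i, t⟫_ℝ = ⟪x i, synthesis b (analysis b t)⟫_ℝ := by
  classical
  let V := Submodule.span ℝ (Set.range x)
  have hm : Module.finrank ℝ V ≤ n := (finrank_range_le_card x).trans hn
  have : FiniteDimensional ℝ V := FiniteDimensional.span_of_finite ℝ (Set.finite_range x)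
  let ob := stdOrthonormalBasis ℝ V
  have hob : Orthonormal ℝ (fun i => (ob i : E)) := by
    have := ob.orthonormal.comp_linearIsometry V.subtypeₗᵢ
    simpa [Function.comp_def] using this
  let e : Fin (Module.finrank ℝ V) → Fin n := Fin.castLE hm
  have he : Function.Injective e := Fin.castLE_injective hm
  -- The span may have dimension below `n`; padding by zeros keeps the number of coordinates fixed.
  let b : Fin n → E := Function.extend e (fun i => (ob i : E)) 0
  have hbe : ∀ i, b (e i) = ob i := fun i => he.extend_apply _ _ i
  have hb0 : ∀ j, j ∉ Set.range e → b j = 0 := fun j hj => by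
    simp only [b]
    rw [Function.extend_apply' _ _ _ (by simpa using hj)]
    rfl
  refine ⟨b, fun j => ?_, fun t => ?_, fun s => ?_, fun i t => ?_⟩
  · by_cases hj : j ∈ Set.range e
    · obtain ⟨i, rfl⟩ := hj
      rw [hbe]
      exact (hob.1 i).le
    · simp [hb0 j hj]
  · rw [← sq_le_sq₀ (norm_nonneg _) (norm_nonneg _), EuclideanSpace.norm_sq_eq]
    rw [sum_eq_sum_comp_of_injective he _ (fun j hj => by simp [analysis, hb0 j hj])]
    simp only [analysis, hbe]
    exact hob.sum_inner_products_le t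
  · rw [← sq_le_sq₀ (norm_nonneg _) (norm_nonneg _), EuclideanSpace.norm_sq_eq, synthesis]
    rw [sum_eq_sum_comp_of_injective he (fun j => s j • b j) (fun j hj => by simp [hb0 j hj])]
    simp only [hbe]
    rw [← real_inner_self_eq_norm_sq, hob.inner_sum]
    calc _ = ∑ i, ‖s (e i)‖ ^ 2 := by
          refine Finset.sum_congr rfl fun i _ => ?_
          simp [sq]
      _ = ∑ j ∈ Finset.univ.image e, ‖s j‖ ^ 2 := by
          rw [Finset.sum_image he.injOn]
      _ ≤ _ := Finset.sum_le_sum_of_subset_of_nonneg (Finset.subset_univ _)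
          (fun _ _ _ => by positivity)
  -- Synthesis after analysis is the orthogonal projection onto the span, which vectors of the span
  -- do not notice.
  · have hxV : x i ∈ V := Submodule.subset_span ⟨i, rfl⟩
    rw [inner_synthesis, sum_eq_sum_comp_of_injective he _ (fun j hj => by simp [hb0 j hj])]
    simp only [analysis, hbe]
    have h1 : x i = ∑ k, ⟪(ob k : E), x i⟫_ℝ • (ob k : E) := by
      have := congrArg (Subtype.val) (ob.sum_repr' ⟨x i, hxV⟩)
      simpa using this.symm
    conv_lhs => rw [h1]
    rw [sum_inner]
    refine Finset.sum_congr rfl fun k _ => ?_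
    rw [inner_smul_left, real_inner_comm (x i)]
    simp [mul_comm]

/-- The complex pairing `⟪x, u⟫ + i ⟪x, v⟫` of `x` with the complex vector `u + i v`. -/
def cdot (x u v : E) : ℂ := (⟪x, u⟫_ℝ : ℂ) + (⟪x, v⟫_ℝ : ℂ) * Complex.I

theorem norm_cdot_le (x u v : E) : ‖cdot x u v‖ ≤ ‖x‖ * (‖u‖ + ‖v‖) := by
  refine (norm_add_le _ _).trans ?_
  rw [norm_mul, Complex.norm_I, mul_one, Complex.norm_real, Complex.norm_real, mul_add]
  exact add_le_add (norm_inner_le_norm x u) (norm_inner_le_norm x v)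

theorem cdot_mul (x u v : E) (z : ℂ) :
    cdot x u v * z = cdot x (z.re • u - z.im • v) (z.re • v + z.im • u) := by
  apply Complex.ext <;> simp [cdot, inner_add_right, inner_sub_right, inner_smul_right] <;> ring

theorem cdot_add (x u v u' v' : E) :
    cdot x u v + cdot x u' v' = cdot x (u + u') (v + v') := by
  apply Complex.ext <;> simp [cdot, inner_add_right]

theorem cdot_smul_right (x u v : E) (r : ℝ) : cdot x (r • u) (r • v) = r * cdot x u v := by
  apply Complex.ext <;> simp [cdot, inner_smul_right]

theorem cdot_re (x u v : E) : (cdot x u v).re = ⟪x, u⟫_ℝ := by simp [cdot]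

theorem norm_exp_cdot (x u v : E) : ‖Complex.exp (cdot x u v)‖ = Real.exp ⟪x, u⟫_ℝ := by
  rw [Complex.norm_exp, cdot_re]

@[fun_prop]
theorem continuous_cdot (u v : E) : Continuous fun x => cdot x u v := by
  unfold cdot; fun_prop

end Frame

/-! ### Exponential integrals of the standard Gaussian measure -/

section Gaussian

open scoped InnerProductSpace

theorem integrable_cexp_gaussianReal (z : ℂ) :
    Integrable (fun x : ℝ => Complex.exp (z * x)) (gaussianReal 0 1) := by
  refine (integrable_exp_mul_gaussianReal (μ := 0) (v := 1) z.re).mono' (by fun_prop) ?_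
  refine .of_forall fun x => ?_
  rw [Complex.norm_exp]
  simp

theorem integral_cexp_gaussianReal (z : ℂ) :
    ∫ x : ℝ, Complex.exp (z * x) ∂(gaussianReal 0 1) = Complex.exp (z ^ 2 / 2) := by
  have := complexMGF_id_gaussianReal (μ := 0) (v := 1) z
  simpa [complexMGF] using this

variable {E : Type*} [NormedAddCommGroup E] [InnerProductSpace ℝ E]

theorem cexp_cdot_sum {m : ℕ} (b : Fin m → E) (u v : E) (x : Fin m → ℝ) :
    Complex.exp (cdot (∑ i, x i • b i) u v) = ∏ i, Complex.exp (cdot (b i) u v * x i) := by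
  rw [← Complex.exp_sum]
  congr 1
  apply Complex.ext <;>
    simp [cdot, sum_inner, inner_smul_left, mul_comm]

/-- The density of `N(μ, I)` with respect to `N(0, I)`. -/
def shiftDensity (μ x : E) : ℝ := Real.exp (⟪x, μ⟫_ℝ - ‖μ‖ ^ 2 / 2)

@[fun_prop]
theorem continuous_shiftDensity (μ : E) : Continuous (shiftDensity μ) := by
  unfold shiftDensity; fun_prop

theorem shiftDensity_pos (μ x : E) : 0 < shiftDensity μ x := Real.exp_pos _

theorem shiftDensity_eq (μ x : E) :
    shiftDensity μ x = Real.exp (-(‖μ‖ ^ 2 / 2)) * Real.exp ⟪x, μ⟫_ℝ := by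
  rw [← Real.exp_add, shiftDensity]; congr 1; ring

theorem shiftDensity_mul_cexp (μ u v x : E) :
    (shiftDensity μ x : ℂ) * Complex.exp (cdot x u v) =
      (Real.exp (-(‖μ‖ ^ 2 / 2)) : ℂ) * Complex.exp (cdot x (u + μ) v) := by
  rw [shiftDensity, Complex.ofReal_exp, Complex.ofReal_exp, ← Complex.exp_add, ← Complex.exp_add]
  congr 1
  apply Complex.ext <;> simp [cdot, inner_add_right]; ring

variable [FiniteDimensional ℝ E] [MeasurableSpace E] [BorelSpace E]

theorem integrable_cexp_cdot (u v : E) :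
    Integrable (fun x => Complex.exp (cdot x u v)) (stdGaussian E) := by
  rw [stdGaussian, integrable_map_measure (by fun_prop) (Measurable.aemeasurable (by fun_prop))]
  simp only [Function.comp_def, cexp_cdot_sum]
  exact Integrable.fintype_prod (f := fun i (x : ℝ) =>
    Complex.exp (cdot (stdOrthonormalBasis ℝ E i) u v * x))
    (fun i => integrable_cexp_gaussianReal _)

theorem integral_cexp_cdot (u v : E) :
    ∫ x, Complex.exp (cdot x u v) ∂(stdGaussian E) =
      Complex.exp (((‖u‖ ^ 2 - ‖v‖ ^ 2) / 2 : ℝ) + (⟪u, v⟫_ℝ : ℂ) * Complex.I) := by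
  rw [stdGaussian, integral_map (Measurable.aemeasurable (by fun_prop)) (by fun_prop)]
  simp only [cexp_cdot_sum]
  rw [integral_fintype_prod_eq_prod (f := fun i (x : ℝ) =>
    Complex.exp (cdot (stdOrthonormalBasis ℝ E i) u v * x))]
  simp only [integral_cexp_gaussianReal]
  rw [← Complex.exp_sum]
  congr 1
  set b := stdOrthonormalBasis ℝ E
  have h1 : ∀ i, cdot (b i) u v ^ 2 / 2 = (((⟪b i, u⟫_ℝ ^ 2 - ⟪b i, v⟫_ℝ ^ 2) / 2 : ℝ) : ℂ) +
      ((⟪u, b i⟫_ℝ * ⟪b i, v⟫_ℝ : ℝ) : ℂ) * Complex.I := by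
    intro i
    rw [real_inner_comm (b i) u]
    apply Complex.ext <;> simp [cdot, sq]; ring
  simp only [h1]
  rw [Finset.sum_add_distrib, ← Finset.sum_mul, ← Complex.ofReal_sum, ← Complex.ofReal_sum,
    b.sum_inner_mul_inner, ← Finset.sum_div, Finset.sum_sub_distrib, b.sum_sq_inner_right,
    b.sum_sq_inner_right]

theorem integrable_exp_inner (u : E) :
    Integrable (fun x => Real.exp ⟪x, u⟫_ℝ) (stdGaussian E) := by
  have := (integrable_cexp_cdot u (0 : E)).norm
  simpa only [norm_exp_cdot] using this

theorem integral_exp_inner (u : E) :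
    ∫ x, Real.exp ⟪x, u⟫_ℝ ∂(stdGaussian E) = Real.exp (‖u‖ ^ 2 / 2) := by
  have := integral_cexp_cdot u (0 : E)
  simp only [cdot, inner_zero_right, Complex.ofReal_zero, zero_mul, add_zero, norm_zero,
    ← Complex.ofReal_exp, integral_complex_ofReal, Complex.ofReal_inj] at this
  simpa using this

theorem integrable_shiftDensity (μ : E) : Integrable (shiftDensity μ) (stdGaussian E) := by
  simp only [funext (shiftDensity_eq μ)]
  exact (integrable_exp_inner μ).const_mul _

theorem integrable_shiftDensity_mul_cexp (μ u v : E) :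
    Integrable (fun x => (shiftDensity μ x : ℂ) * Complex.exp (cdot x u v)) (stdGaussian E) := by
  simp only [shiftDensity_mul_cexp]
  exact (integrable_cexp_cdot _ _).const_mul _

theorem integral_shiftDensity_mul_cexp (μ u v : E) :
    ∫ x, (shiftDensity μ x : ℂ) * Complex.exp (cdot x u v) ∂(stdGaussian E) =
      Complex.exp (cdot μ u v) *
        Complex.exp (((‖u‖ ^ 2 - ‖v‖ ^ 2) / 2 : ℝ) + (⟪u, v⟫_ℝ : ℂ) * Complex.I) := by
  simp only [shiftDensity_mul_cexp]
  rw [integral_const_mul, integral_cexp_cdot, Complex.ofReal_exp, ← Complex.exp_add,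
    ← Complex.exp_add, norm_add_sq_real]
  congr 1
  apply Complex.ext <;> simp [cdot, inner_add_left, real_inner_comm] <;> ring

/-- The translation formula of Cameron and Martin in finite dimension. -/
theorem map_add_stdGaussian (μ : E) :
    (stdGaussian E).map (fun x => μ + x) =
      (stdGaussian E).withDensity (fun x => ENNReal.ofReal (shiftDensity μ x)) := by
  have : IsFiniteMeasure
      ((stdGaussian E).withDensity (fun x => ENNReal.ofReal (shiftDensity μ x))) :=
    isFiniteMeasure_withDensity_ofReal (integrable_shiftDensity μ).2
  have : IsFiniteMeasure ((stdGaussian E).map (fun x => μ + x)) :=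
    Measure.isFiniteMeasure_map _ _
  apply Measure.ext_of_charFun
  ext t
  have h0 : ∀ x : E, Complex.exp ((⟪x, t⟫_ℝ : ℂ) * Complex.I) = Complex.exp (cdot x 0 t) := by
    intro x; simp [cdot]
  rw [charFun_apply, charFun_apply, integral_map (by fun_prop) (by fun_prop),
    integral_withDensity_eq_integral_toReal_smul (by fun_prop) (by simp)]
  simp only [ENNReal.toReal_ofReal (shiftDensity_pos _ _).le, Complex.real_smul, h0]
  rw [integral_shiftDensity_mul_cexp]
  have h1 : ∀ x : E, Complex.exp (cdot (μ + x) 0 t) =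
      Complex.exp (cdot μ 0 t) * Complex.exp (cdot x 0 t) := by
    intro x
    rw [← Complex.exp_add]; congr 1
    apply Complex.ext <;> simp [cdot, inner_add_left]
  simp only [h1]
  rw [integral_const_mul, integral_cexp_cdot]

/-- The Euclidean norm is at most the `ℓ¹` norm, which is the inner product with a suitable sign
vector. Summing over all `2^n` sign vectors reduces to explicit Gaussian integrals. -/
theorem integral_exp_norm_le {n : ℕ} {c : ℝ} (hc : 0 ≤ c) :
    Integrable (fun x => Real.exp (c * ‖x‖)) (stdGaussian (EuclideanSpace ℝ (Fin n))) ∧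
    ∫ x, Real.exp (c * ‖x‖) ∂(stdGaussian (EuclideanSpace ℝ (Fin n))) ≤
      (2 * Real.exp (c ^ 2 / 2)) ^ n := by
  let σ : (Fin n → Bool) → EuclideanSpace ℝ (Fin n) :=
    fun p => WithLp.toLp 2 fun j => if p j then c else -c
  have hσ : ∀ p, ‖σ p‖ ^ 2 = n * c ^ 2 := by
    intro p
    rw [EuclideanSpace.norm_sq_eq]
    simp only [σ]
    rw [Finset.sum_congr rfl (g := fun _ => c ^ 2)]
    · simp
    · intro j _
      split_ifs <;> simp
  have hint : Integrable (fun x => ∑ p, Real.exp ⟪x, σ p⟫_ℝ)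
      (stdGaussian (EuclideanSpace ℝ (Fin n))) :=
    integrable_finsetSum _ fun p _ => integrable_exp_inner _
  have hle : ∀ x : EuclideanSpace ℝ (Fin n), Real.exp (c * ‖x‖) ≤ ∑ p, Real.exp ⟪x, σ p⟫_ℝ := by
    intro x
    let p : Fin n → Bool := fun j => decide (0 ≤ x j)
    have hp : c * ‖x‖ ≤ ⟪x, σ p⟫_ℝ := by
      have h1 : ⟪x, σ p⟫_ℝ = c * ∑ j, |x j| := by
        rw [PiLp.inner_apply, Finset.mul_sum]
        refine Finset.sum_congr rfl fun j _ => ?_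
        by_cases h : 0 ≤ x j
        · simp [σ, p, h, abs_of_nonneg h]
        · simp [σ, p, h, abs_of_neg (not_le.1 h)]
      rw [h1]
      gcongr
      rw [EuclideanSpace.norm_eq]
      refine Real.sqrt_le_iff.2 ⟨by positivity, ?_⟩
      simp only [Real.norm_eq_abs]
      exact Finset.sum_sq_le_sq_sum_of_nonneg (fun j _ => abs_nonneg _)
    exact (Real.exp_le_exp.2 hp).trans
      (Finset.single_le_sum (f := fun p => Real.exp ⟪x, σ p⟫_ℝ)
        (fun q _ => (Real.exp_pos _).le) (Finset.mem_univ p))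
  have hint2 : Integrable (fun x => Real.exp (c * ‖x‖))
      (stdGaussian (EuclideanSpace ℝ (Fin n))) :=
    hint.mono' (by fun_prop) (.of_forall fun x => by
      rw [Real.norm_of_nonneg (Real.exp_pos _).le]; exact hle x)
  refine ⟨hint2, (integral_mono hint2 hint hle).trans ?_⟩
  rw [integral_finsetSum _ fun p _ => integrable_exp_inner _]
  simp only [integral_exp_inner, hσ]
  simp only [Finset.sum_const, Finset.card_univ, Fintype.card_fun, Fintype.card_bool,
    Fintype.card_fin, nsmul_eq_mul]
  rw [mul_pow, ← Real.exp_nat_mul]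
  push_cast
  rw [mul_div_assoc]

/-- The Gram sum of exponentials is the second moment of the Laplace transform under a complex
Gaussian vector. -/
theorem sum_mul_exp_inner_le {ι : Type*} [Fintype ι] {n : ℕ} (a : ι → ℝ)
    (y : ι → EuclideanSpace ℝ (Fin n)) {M c : ℝ} (hM : 0 ≤ M) (hc : 0 ≤ c)
    (hK : ∀ u v, ‖∑ i, (a i : ℂ) * Complex.exp (cdot (y i) u v)‖ ≤
      M * Real.exp (c * (‖u‖ + ‖v‖))) :
    ∑ i, ∑ j, a i * a j * Real.exp ⟪y i, y j⟫_ℝ ≤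
      M ^ 2 * ((2 * Real.exp ((2 * c) ^ 2 / 2)) ^ n) ^ 2 := by
  set γ := stdGaussian (EuclideanSpace ℝ (Fin n)) with hγ
  -- Real and imaginary parts get covariance `I/2`. Then the terms in `‖y i‖²` and `‖y j‖²` cancel,
  -- and the mixed second moment of the exponentials is exactly `exp ⟪y i, y j⟫`.
  set r : ℝ := √2⁻¹ with hr
  have hr2 : r ^ 2 = 2⁻¹ := Real.sq_sqrt (by norm_num)
  have hr0 : 0 ≤ r := Real.sqrt_nonneg _
  have hr1 : r ≤ 1 := by nlinarith
  let K : EuclideanSpace ℝ (Fin n) × EuclideanSpace ℝ (Fin n) → ℂ := fun p =>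
    ∑ i, (a i : ℂ) * Complex.exp (cdot (y i) (r • p.1) (r • p.2))
  let T : ι → ι → EuclideanSpace ℝ (Fin n) × EuclideanSpace ℝ (Fin n) → ℂ := fun i j p =>
    Complex.exp (cdot p.1 (r • (y i + y j)) 0) * Complex.exp (cdot p.2 0 (r • (y i - y j)))
  have hTint : ∀ i j, Integrable (T i j) (γ.prod γ) := fun i j =>
    (integrable_cexp_cdot _ _).mul_prod (integrable_cexp_cdot _ _)
  have hTval : ∀ i j, ∫ p, T i j p ∂(γ.prod γ) = (Real.exp ⟪y i, y j⟫_ℝ : ℂ) := by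
    intro i j
    simp only [T]
    rw [integral_prod_mul (fun x => Complex.exp (cdot x (r • (y i + y j)) 0))
      (fun x => Complex.exp (cdot x 0 (r • (y i - y j)))), integral_cexp_cdot,
      integral_cexp_cdot, ← Complex.exp_add, Complex.ofReal_exp]
    congr 1
    simp only [norm_smul, mul_pow, norm_add_sq_real, norm_sub_sq_real, Real.norm_eq_abs, sq_abs,
      hr2, norm_zero, inner_zero_left, inner_zero_right]
    push_cast
    ring
  have hKT : ∀ p, ((‖K p‖ ^ 2 : ℝ) : ℂ) = ∑ i, ∑ j, ((a i * a j : ℝ) : ℂ) * T i j p := by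
    intro p
    rw [Complex.ofReal_pow, ← Complex.mul_conj']
    simp only [K, map_sum, Finset.sum_mul_sum]
    refine Finset.sum_congr rfl fun i _ => Finset.sum_congr rfl fun j _ => ?_
    simp only [T]
    rw [map_mul, ← Complex.exp_conj, Complex.conj_ofReal, mul_mul_mul_comm, ← Complex.exp_add,
      ← Complex.exp_add, ← Complex.ofReal_mul]
    congr 2
    apply Complex.ext <;>
      simp [cdot, inner_smul_right, inner_add_right, inner_sub_right, real_inner_comm]; ring
  have hKc : ∫ p, ((‖K p‖ ^ 2 : ℝ) : ℂ) ∂(γ.prod γ) =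
      ((∑ i, ∑ j, a i * a j * Real.exp ⟪y i, y j⟫_ℝ : ℝ) : ℂ) := by
    simp only [hKT]
    rw [integral_finsetSum _ fun i _ => integrable_finsetSum _ fun j _ => (hTint i j).const_mul _]
    push_cast
    refine Finset.sum_congr rfl fun i _ => ?_
    rw [integral_finsetSum _ fun j _ => (hTint i j).const_mul _]
    refine Finset.sum_congr rfl fun j _ => ?_
    rw [integral_const_mul, hTval]
    push_cast
    rfl
  rw [integral_complex_ofReal, Complex.ofReal_inj] at hKc
  rw [← hKc]
  have hI := integral_exp_norm_le (n := n) (c := 2 * c) (by positivity)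
  have hprod : Integrable (fun p : EuclideanSpace ℝ (Fin n) × EuclideanSpace ℝ (Fin n) =>
      M ^ 2 * (Real.exp (2 * c * ‖p.1‖) * Real.exp (2 * c * ‖p.2‖))) (γ.prod γ) :=
    (hI.1.mul_prod hI.1).const_mul _
  calc ∫ p, ‖K p‖ ^ 2 ∂(γ.prod γ)
      ≤ ∫ p, M ^ 2 * (Real.exp (2 * c * ‖p.1‖) * Real.exp (2 * c * ‖p.2‖)) ∂(γ.prod γ) := by
        refine integral_mono_of_nonneg (.of_forall fun p => by positivity) hprod
          (.of_forall fun p => ?_)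
        have h1 := hK (r • p.1) (r • p.2)
        simp only [norm_smul, Real.norm_of_nonneg hr0] at h1
        calc ‖K p‖ ^ 2 ≤ (M * Real.exp (c * (‖p.1‖ + ‖p.2‖))) ^ 2 := by
              gcongr
              refine h1.trans ?_
              gcongr
              · exact mul_le_of_le_one_left (norm_nonneg _) hr1
              · exact mul_le_of_le_one_left (norm_nonneg _) hr1
          _ = M ^ 2 * (Real.exp (2 * c * ‖p.1‖) * Real.exp (2 * c * ‖p.2‖)) := by
              rw [mul_pow, ← Real.exp_nat_mul, ← Real.exp_add]
              congr 2
              push_cast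
              ring
    _ = M ^ 2 * ((∫ x, Real.exp (2 * c * ‖x‖) ∂γ) * (∫ x, Real.exp (2 * c * ‖x‖) ∂γ)) := by
        rw [integral_const_mul, integral_prod_mul (fun x => Real.exp (2 * c * ‖x‖))
          (fun x => Real.exp (2 * c * ‖x‖))]
    _ ≤ _ := by
        rw [← sq]
        gcongr
        exact hI.2

end Gaussian

/-! ### Hellinger distance -/

section Hellinger

variable {Ω : Type*} [MeasurableSpace Ω]

theorem integral_abs_mul_abs_le {μ : Measure Ω} {f g : Ω → ℝ} (hf : MemLp f 2 μ)
    (hg : MemLp g 2 μ) :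
    ∫ x, |f x| * |g x| ∂μ ≤ √(∫ x, f x ^ 2 ∂μ) * √(∫ x, g x ^ 2 ∂μ) := by
  have h := integral_mul_le_Lp_mul_Lq_of_nonneg (μ := μ) Real.HolderConjugate.two_two
    (f := fun x => |f x|) (g := fun x => |g x|)
    (.of_forall fun x => abs_nonneg _) (.of_forall fun x => abs_nonneg _)
    (by simpa using hf.norm) (by simpa using hg.norm)
  simpa [Real.sqrt_eq_rpow] using h

theorem hellinger_sq (P Q : Measure Ω) :
    hellinger P Q ^ 2 = ∫ x, (√(P.rnDeriv (P + Q) x).toReal -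
      √(Q.rnDeriv (P + Q) x).toReal) ^ 2 ∂(P + Q) :=
  Real.sq_sqrt (integral_nonneg fun _ => sq_nonneg _)

theorem hellinger_nonneg (P Q : Measure Ω) : 0 ≤ hellinger P Q := Real.sqrt_nonneg _

variable (P Q : Measure Ω) [IsFiniteMeasure P] [IsFiniteMeasure Q]

/-- With `P + Q` dominating, `√p + √q` lies between `1` and `2`, so `|√p - √q|` and `|p - q|` are
comparable. Each half of this is used in one direction of the comparison with moments. -/
theorem rnDeriv_toReal_add_eq_one :
    ∀ᵐ x ∂(P + Q), (P.rnDeriv (P + Q) x).toReal + (Q.rnDeriv (P + Q) x).toReal = 1 := by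
  filter_upwards [Measure.rnDeriv_add' P Q (P + Q), Measure.rnDeriv_self (P + Q),
    Measure.rnDeriv_lt_top P (P + Q), Measure.rnDeriv_lt_top Q (P + Q)] with x h1 h2 h3 h4
  rw [← ENNReal.toReal_add h3.ne h4.ne, ← Pi.add_apply, ← h1, h2]
  simp

theorem integral_sub_integral_eq_rnDeriv {F : Type*} [NormedAddCommGroup F] [NormedSpace ℝ F]
    {f : Ω → F} (hf : Integrable f (P + Q)) :
    ∫ x, f x ∂P - ∫ x, f x ∂Q = ∫ x, ((P.rnDeriv (P + Q) x).toReal -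
      (Q.rnDeriv (P + Q) x).toReal) • f x ∂(P + Q) := by
  have hP : P ≪ P + Q := Measure.le_add_right le_rfl |>.absolutelyContinuous
  have hQ : Q ≪ P + Q := Measure.le_add_left le_rfl |>.absolutelyContinuous
  simp only [sub_smul]
  rw [integral_sub ((integrable_rnDeriv_smul_iff hP).2 hf.left_of_add_measure)
    ((integrable_rnDeriv_smul_iff hQ).2 hf.right_of_add_measure), integral_rnDeriv_smul hP,
    integral_rnDeriv_smul hQ]

theorem memLp_sqrt_rnDeriv_sub : MemLp (fun x => √(P.rnDeriv (P + Q) x).toReal -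
    √(Q.rnDeriv (P + Q) x).toReal) 2 (P + Q) := by
  refine MemLp.of_bound (C := 1) ?_ ?_
  · exact Measurable.aestronglyMeasurable (by fun_prop)
  · filter_upwards [rnDeriv_toReal_add_eq_one P Q] with x hx
    have h1 : √(P.rnDeriv (P + Q) x).toReal ≤ 1 := Real.sqrt_le_one.2 (by
      linarith [ENNReal.toReal_nonneg (a := Q.rnDeriv (P + Q) x)])
    have h2 : √(Q.rnDeriv (P + Q) x).toReal ≤ 1 := Real.sqrt_le_one.2 (by
      linarith [ENNReal.toReal_nonneg (a := P.rnDeriv (P + Q) x)])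
    rw [Real.norm_eq_abs, abs_le]
    constructor <;> linarith [Real.sqrt_nonneg (P.rnDeriv (P + Q) x).toReal,
      Real.sqrt_nonneg (Q.rnDeriv (P + Q) x).toReal]

/-- Expectations of square-integrable functions are Lipschitz in the Hellinger distance. -/
theorem norm_integral_sub_integral_le {f : Ω → ℂ} (hf : MemLp f 2 (P + Q)) :
    ‖∫ x, f x ∂P - ∫ x, f x ∂Q‖ ≤ 2 * hellinger P Q * √(∫ x, ‖f x‖ ^ 2 ∂(P + Q)) := by
  set p : Ω → ℝ := fun x => (P.rnDeriv (P + Q) x).toReal with hp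
  set q : Ω → ℝ := fun x => (Q.rnDeriv (P + Q) x).toReal with hq
  have hfi : Integrable f (P + Q) := hf.integrable one_le_two
  have hgi : MemLp (fun x => √(p x) - √(q x)) 2 (P + Q) := memLp_sqrt_rnDeriv_sub P Q
  rw [integral_sub_integral_eq_rnDeriv P Q hfi]
  have hint : Integrable (fun x => |√(p x) - √(q x)| * |‖f x‖|) (P + Q) := by
    have := hgi.norm.integrable_mul hf.norm
    simpa [Pi.mul_def] using this
  calc _ ≤ ∫ x, 2 * (|√(p x) - √(q x)| * |‖f x‖|) ∂(P + Q) := by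
        refine norm_integral_le_of_norm_le (hint.const_mul 2) ?_
        filter_upwards [rnDeriv_toReal_add_eq_one P Q] with x hx
        have hp0 : 0 ≤ p x := ENNReal.toReal_nonneg
        have hq0 : 0 ≤ q x := ENNReal.toReal_nonneg
        change p x + q x = 1 at hx
        have h1 : √(p x) ≤ 1 := Real.sqrt_le_one.2 (by linarith)
        have h2 : √(q x) ≤ 1 := Real.sqrt_le_one.2 (by linarith)
        have h3 : p x - q x = (√(p x) - √(q x)) * (√(p x) + √(q x)) := by
          nlinarith [Real.sq_sqrt hp0, Real.sq_sqrt hq0]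
        change ‖(p x - q x) • f x‖ ≤ _
        rw [norm_smul, h3, Real.norm_eq_abs, abs_mul, abs_of_nonneg (norm_nonneg (f x)),
          abs_of_nonneg (add_nonneg (Real.sqrt_nonneg (p x)) (Real.sqrt_nonneg (q x)))]
        have : √(p x) + √(q x) ≤ 2 := by linarith
        calc _ ≤ |√(p x) - √(q x)| * 2 * ‖f x‖ := by gcongr
          _ = _ := by ring
    _ ≤ 2 * (√(∫ x, (√(p x) - √(q x)) ^ 2 ∂(P + Q)) * √(∫ x, ‖f x‖ ^ 2 ∂(P + Q))) := by
        rw [integral_const_mul]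
        gcongr
        exact integral_abs_mul_abs_le hgi hf.norm
    _ = _ := by rw [hellinger, mul_assoc]

/-- Comparison of the Hellinger distance with a weighted `L²` distance of densities. -/
theorem hellinger_sq_le_of_withDensity {γ : Measure Ω} {g₁ g₂ W : Ω → ℝ} {c : ℝ} (hc : 0 ≤ c)
    (hg₁ : Measurable g₁) (hg₂ : Measurable g₂) (hW : Measurable W) (hg₁0 : ∀ x, 0 ≤ g₁ x)
    (hg₂0 : ∀ x, 0 ≤ g₂ x) (hg₁i : Integrable g₁ γ) (hg₂i : Integrable g₂ γ)
    (hP : P = γ.withDensity fun x => ENNReal.ofReal (g₁ x))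
    (hQ : Q = γ.withDensity fun x => ENNReal.ofReal (g₂ x))
    (hW0 : ∀ x, 0 < W x) (hWg : ∀ x, W x ≤ c * g₂ x)
    (hT : Integrable (fun x => (g₁ x - g₂ x) ^ 2 / W x) γ) :
    hellinger P Q ^ 2 ≤ c * ∫ x, (g₁ x - g₂ x) ^ 2 / W x ∂γ := by
  set p : Ω → ℝ := fun x => (P.rnDeriv (P + Q) x).toReal with hp
  set q : Ω → ℝ := fun x => (Q.rnDeriv (P + Q) x).toReal with hq
  -- Truncation bounds `p - q` everywhere and not only `P + Q`-almost everywhere, so `f` can be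
  -- integrated against `γ` as well.
  set f : Ω → ℝ := fun x => max (-1) (min 1 (p x - q x)) with hfdef
  have hfm : Measurable f := by fun_prop
  have hf1 : ∀ x, |f x| ≤ 1 := fun x => abs_le.2 ⟨le_max_left _ _,
    max_le (by norm_num) (min_le_left _ _)⟩
  have hf2 : ∀ x, f x ^ 2 ≤ 1 := fun x => by
    rw [← sq_abs]; exact pow_le_one₀ (abs_nonneg _) (hf1 x)
  have hfi : Integrable f (P + Q) :=
    Integrable.of_bound hfm.aestronglyMeasurable 1 (.of_forall hf1)
  have hf2i : Integrable (fun x => f x ^ 2) (P + Q) :=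
    Integrable.of_bound (by fun_prop) 1 (.of_forall fun x => by
      rw [Real.norm_of_nonneg (sq_nonneg _)]; exact hf2 x)
  have hfpq : ∀ᵐ x ∂(P + Q), f x = p x - q x := by
    filter_upwards [rnDeriv_toReal_add_eq_one P Q] with x hx
    have hp0 : 0 ≤ p x := ENNReal.toReal_nonneg
    have hq0 : 0 ≤ q x := ENNReal.toReal_nonneg
    change p x + q x = 1 at hx
    simp only [hfdef]
    rw [min_eq_right (by linarith), max_eq_right (by linarith)]
  have hintP : ∀ h : Ω → ℝ, ∫ x, h x ∂P = ∫ x, g₁ x * h x ∂γ := by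
    intro h
    rw [hP, integral_withDensity_eq_integral_toReal_smul (by fun_prop) (by simp)]
    simp only [ENNReal.toReal_ofReal (hg₁0 _), smul_eq_mul]
  have hintQ : ∀ h : Ω → ℝ, ∫ x, h x ∂Q = ∫ x, g₂ x * h x ∂γ := by
    intro h
    rw [hQ, integral_withDensity_eq_integral_toReal_smul (by fun_prop) (by simp)]
    simp only [ENNReal.toReal_ofReal (hg₂0 _), smul_eq_mul]
  set A := ∫ x, f x ^ 2 ∂(P + Q) with hA
  set T := ∫ x, (g₁ x - g₂ x) ^ 2 / W x ∂γ with hTdef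
  have hT0 : 0 ≤ T := integral_nonneg fun x => div_nonneg (sq_nonneg _) (hW0 x).le
  have hA0 : 0 ≤ A := integral_nonneg fun x => sq_nonneg _
  have hHA : hellinger P Q ^ 2 ≤ A := by
    rw [hellinger_sq]
    refine integral_mono_ae (memLp_sqrt_rnDeriv_sub P Q).integrable_sq hf2i ?_
    filter_upwards [hfpq, rnDeriv_toReal_add_eq_one P Q] with x hx hx1
    have hp0 : 0 ≤ p x := ENNReal.toReal_nonneg
    have hq0 : 0 ≤ q x := ENNReal.toReal_nonneg
    change p x + q x = 1 at hx1
    change (√(p x) - √(q x)) ^ 2 ≤ f x ^ 2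
    have h3 : p x - q x = (√(p x) - √(q x)) * (√(p x) + √(q x)) := by
      nlinarith [Real.sq_sqrt hp0, Real.sq_sqrt hq0]
    rw [hx, h3, mul_pow]
    refine le_mul_of_one_le_right (sq_nonneg _) ?_
    nlinarith [Real.sq_sqrt hp0, Real.sq_sqrt hq0,
      mul_nonneg (Real.sqrt_nonneg (p x)) (Real.sqrt_nonneg (q x))]
  have hb : ∀ g : Ω → ℝ, Integrable g γ → Integrable (fun x => g x * f x) γ := fun g hg =>
    hg.mul_bdd (c := 1) hfm.aestronglyMeasurable (.of_forall hf1)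
  -- Testing the difference of the measures against `f = p - q` itself gives back `A`.
  -- Cauchy–Schwarz with weight `W` and the domination of `W` by `c g₂` will give `A ≤ √(cA) √T`,
  -- from which `A ≤ cT` follows.
  have hA1 : A = ∫ x, f x * (g₁ x - g₂ x) ∂γ := by
    have h1 : A = ∫ x, (p x - q x) • f x ∂(P + Q) := by
      refine integral_congr_ae ?_
      filter_upwards [hfpq] with x hx
      rw [smul_eq_mul, ← hx, sq]
    rw [h1, ← integral_sub_integral_eq_rnDeriv P Q hfi, hintP, hintQ,
      ← integral_sub (hb _ hg₁i) (hb _ hg₂i)]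
    exact integral_congr_ae (.of_forall fun x => by ring)
  have hWi : Integrable (fun x => f x ^ 2 * W x) γ := by
    refine (hg₂i.const_mul c).mono' (by fun_prop) (.of_forall fun x => ?_)
    rw [Real.norm_of_nonneg (mul_nonneg (sq_nonneg _) (hW0 x).le)]
    exact (mul_le_of_le_one_left (hW0 x).le (hf2 x)).trans (hWg x)
  have hWA : ∫ x, f x ^ 2 * W x ∂γ ≤ c * A := by
    calc _ ≤ ∫ x, c * (g₂ x * f x ^ 2) ∂γ := by
          refine integral_mono hWi ?_ fun x => ?_
          · refine (hg₂i.mul_bdd (c := 1) (by fun_prop) (.of_forall fun x => ?_)).const_mul c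
            rw [Real.norm_of_nonneg (sq_nonneg _)]
            exact hf2 x
          · calc f x ^ 2 * W x ≤ f x ^ 2 * (c * g₂ x) := by
                  have := hWg x
                  gcongr
              _ = _ := by ring
      _ = c * ∫ x, f x ^ 2 ∂Q := by rw [integral_const_mul, hintQ]
      _ ≤ c * A := by
          gcongr
          rw [hA, integral_add_measure hf2i.left_of_add_measure hf2i.right_of_add_measure]
          exact le_add_of_nonneg_left (integral_nonneg fun x => sq_nonneg _)
  have hCS : A ≤ √(∫ x, f x ^ 2 * W x ∂γ) * √T := by
    have hs : ∀ x, √(W x) ^ 2 = W x := fun x => Real.sq_sqrt (hW0 x).le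
    have hs0 : ∀ x, √(W x) ≠ 0 := fun x => (Real.sqrt_pos.2 (hW0 x)).ne'
    have e1 : ∀ x, (f x * √(W x)) ^ 2 = f x ^ 2 * W x := fun x => by rw [mul_pow, hs]
    have e2 : ∀ x, ((g₁ x - g₂ x) / √(W x)) ^ 2 = (g₁ x - g₂ x) ^ 2 / W x := fun x => by
      rw [div_pow, hs]
    have m1 : MemLp (fun x => f x * √(W x)) 2 γ :=
      (memLp_two_iff_integrable_sq (by fun_prop)).2 (by simpa only [e1] using hWi)
    have m2 : MemLp (fun x => (g₁ x - g₂ x) / √(W x)) 2 γ :=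
      (memLp_two_iff_integrable_sq (Measurable.aestronglyMeasurable (by fun_prop))).2 (by simpa only [e2] using hT)
    have h := integral_abs_mul_abs_le m1 m2
    simp only [e1, e2] at h
    refine le_trans ?_ h
    rw [hA1]
    refine (le_abs_self _).trans ((abs_integral_le_integral_abs).trans (le_of_eq ?_))
    refine integral_congr_ae (.of_forall fun x => ?_)
    simp only
    rw [← abs_mul]
    congr 1
    field_simp [hs0 x]
  refine hHA.trans ?_
  rcases hA0.eq_or_lt with h0 | hpos
  · rw [← h0]; positivity
  have h2 : A ≤ √(c * A) * √T := hCS.trans (by gcongr)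
  have h3 : A ^ 2 ≤ c * A * T := by
    calc A ^ 2 ≤ (√(c * A) * √T) ^ 2 := by gcongr
      _ = c * A * T := by rw [mul_pow, Real.sq_sqrt (by positivity), Real.sq_sqrt hT0]
  nlinarith

end Hellinger

/-! ### Densities of Gaussian mixtures -/

section Mixture

open scoped InnerProductSpace

variable {d k : ℕ}

/-- The density of the mixture `∑ j, w j • N(μ j, I)` with respect to `N(0, I)`. -/
def mixDensity (w : Fin k → ℝ≥0) (μ : Fin k → EuclideanSpace ℝ (Fin d))
    (x : EuclideanSpace ℝ (Fin d)) : ℝ :=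
  ∑ j, (w j : ℝ) * shiftDensity (μ j) x

@[fun_prop]
theorem continuous_mixDensity (w : Fin k → ℝ≥0) (μ : Fin k → EuclideanSpace ℝ (Fin d)) :
    Continuous (mixDensity w μ) := by
  unfold mixDensity; fun_prop

theorem mixDensity_nonneg (w : Fin k → ℝ≥0) (μ : Fin k → EuclideanSpace ℝ (Fin d))
    (x : EuclideanSpace ℝ (Fin d)) : 0 ≤ mixDensity w μ x :=
  Finset.sum_nonneg fun j _ => mul_nonneg (w j).2 (shiftDensity_pos _ _).le

theorem integrable_mixDensity (w : Fin k → ℝ≥0) (μ : Fin k → EuclideanSpace ℝ (Fin d)) :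
    Integrable (mixDensity w μ) (stdGaussian (EuclideanSpace ℝ (Fin d))) :=
  integrable_finsetSum _ fun j _ => (integrable_shiftDensity (μ j)).const_mul _

theorem mixture_eq_withDensity (w : Fin k → ℝ≥0) (μ : Fin k → EuclideanSpace ℝ (Fin d)) :
    mixture (∑ j, w j • Measure.dirac (μ j)) =
      (stdGaussian (EuclideanSpace ℝ (Fin d))).withDensity
        (fun x => ENNReal.ofReal (mixDensity w μ x)) := by
  refine Measure.ext_of_lintegral _ fun f hf => ?_
  rw [mixture, Measure.lintegral_conv hf, lintegral_finsetSum_measure,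
    lintegral_withDensity_eq_lintegral_mul _ (by fun_prop) hf]
  have h1 : ∀ x, ((fun x => ENNReal.ofReal (mixDensity w μ x)) * f) x =
      ∑ j, (w j : ℝ≥0∞) * (ENNReal.ofReal (shiftDensity (μ j) x) * f x) := by
    intro x
    rw [Pi.mul_apply, mixDensity, ENNReal.ofReal_sum_of_nonneg
      (f := fun j => (w j : ℝ) * shiftDensity (μ j) x)
      (fun j _ => mul_nonneg (w j).2 (shiftDensity_pos _ _).le), Finset.sum_mul]
    refine Finset.sum_congr rfl fun j _ => ?_
    rw [ENNReal.ofReal_mul (NNReal.coe_nonneg (w j)), ENNReal.ofReal_coe_nnreal, mul_assoc]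
  simp only [h1]
  rw [lintegral_finsetSum _ (fun j _ => by fun_prop)]
  refine Finset.sum_congr rfl fun j _ => ?_
  rw [lintegral_smul_measure, lintegral_dirac' _ (by fun_prop), lintegral_const_mul _ (by fun_prop)]
  have h2 := congrArg (fun ν => ∫⁻ x, f x ∂ν) (map_add_stdGaussian (μ j))
  simp only at h2
  rw [lintegral_map hf (by fun_prop),
    lintegral_withDensity_eq_lintegral_mul _ (by fun_prop) hf] at h2
  rw [h2]
  rfl

theorem isProbabilityMeasure_mixture {w : Fin k → ℝ≥0} (hw : ∑ j, w j = 1)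
    (μ : Fin k → EuclideanSpace ℝ (Fin d)) :
    IsProbabilityMeasure (mixture (∑ j, w j • Measure.dirac (μ j))) := by
  have : IsProbabilityMeasure (∑ j, w j • Measure.dirac (μ j)) := ⟨by
    simp only [Measure.coe_finsetSum, Finset.sum_apply, Measure.smul_apply, measure_univ]
    simp only [ENNReal.smul_def, smul_eq_mul, mul_one]
    rw [← ENNReal.ofNNReal_finsetSum, hw, ENNReal.coe_one]⟩
  unfold mixture
  infer_instance

theorem integral_mixture {F : Type*} [NormedAddCommGroup F] [NormedSpace ℝ F] (w : Fin k → ℝ≥0)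
    (μ : Fin k → EuclideanSpace ℝ (Fin d)) (f : EuclideanSpace ℝ (Fin d) → F) :
    ∫ x, f x ∂(mixture (∑ j, w j • Measure.dirac (μ j))) =
      ∫ x, mixDensity w μ x • f x ∂(stdGaussian (EuclideanSpace ℝ (Fin d))) := by
  rw [mixture_eq_withDensity, integral_withDensity_eq_integral_toReal_smul (by fun_prop) (by simp)]
  simp only [ENNReal.toReal_ofReal (mixDensity_nonneg _ _ _)]

theorem integrable_mixture_cexp (w : Fin k → ℝ≥0) (μ : Fin k → EuclideanSpace ℝ (Fin d))
    (u v : EuclideanSpace ℝ (Fin d)) :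
    Integrable (fun x => Complex.exp (cdot x u v))
      (mixture (∑ j, w j • Measure.dirac (μ j))) := by
  rw [mixture_eq_withDensity, integrable_withDensity_iff_integrable_smul' (by fun_prop) (by simp)]
  simp only [ENNReal.toReal_ofReal (mixDensity_nonneg _ _ _)]
  simp only [mixDensity, Complex.real_smul, Complex.ofReal_sum, Finset.sum_mul, Complex.ofReal_mul,
    mul_assoc]
  exact integrable_finsetSum _ fun j _ => (integrable_shiftDensity_mul_cexp _ _ _).const_mul _

/-- The Gaussian factor does not depend on the mixing measure. It can be divided out of a difference
of two mixtures, leaving the Laplace transform of the signed mixing measure. -/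
theorem integral_mixture_cexp (w : Fin k → ℝ≥0) (μ : Fin k → EuclideanSpace ℝ (Fin d))
    (u v : EuclideanSpace ℝ (Fin d)) :
    ∫ x, Complex.exp (cdot x u v) ∂(mixture (∑ j, w j • Measure.dirac (μ j))) =
      (∑ j, ((w j : ℝ) : ℂ) * Complex.exp (cdot (μ j) u v)) *
        Complex.exp (((‖u‖ ^ 2 - ‖v‖ ^ 2) / 2 : ℝ) + (⟪u, v⟫_ℝ : ℂ) * Complex.I) := by
  rw [integral_mixture]
  simp only [mixDensity, Complex.real_smul, Complex.ofReal_sum, Finset.sum_mul, Complex.ofReal_mul,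
    mul_assoc]
  rw [integral_finsetSum _ fun j _ => (integrable_shiftDensity_mul_cexp _ _ _).const_mul _]
  simp only [integral_const_mul, integral_shiftDensity_mul_cexp]

theorem integrable_mixture_exp (w : Fin k → ℝ≥0) (μ : Fin k → EuclideanSpace ℝ (Fin d))
    (u : EuclideanSpace ℝ (Fin d)) :
    Integrable (fun x => Real.exp ⟪x, u⟫_ℝ) (mixture (∑ j, w j • Measure.dirac (μ j))) := by
  simpa only [norm_exp_cdot] using (integrable_mixture_cexp w μ u 0).norm

theorem integral_mixture_exp_le {R : ℝ} {w : Fin k → ℝ≥0} (hw : ∑ j, w j = 1)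
    {μ : Fin k → EuclideanSpace ℝ (Fin d)} (hμ : ∀ j, ‖μ j‖ ≤ R) (u : EuclideanSpace ℝ (Fin d)) :
    ∫ x, Real.exp ⟪x, u⟫_ℝ ∂(mixture (∑ j, w j • Measure.dirac (μ j))) ≤
      Real.exp (R * ‖u‖ + ‖u‖ ^ 2 / 2) := by
  have h := integral_mixture_cexp w μ u 0
  simp only [cdot, inner_zero_right, Complex.ofReal_zero, zero_mul, add_zero, norm_zero,
    ← Complex.ofReal_exp, integral_complex_ofReal, ← Complex.ofReal_mul, ← Complex.ofReal_sum,
    Complex.ofReal_inj] at h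
  rw [h, Real.exp_add]
  have hw' : ∑ j, (w j : ℝ) = 1 := by exact_mod_cast hw
  gcongr ?_ * ?_
  · calc ∑ j, (w j : ℝ) * Real.exp ⟪μ j, u⟫_ℝ ≤ ∑ j, (w j : ℝ) * Real.exp (R * ‖u‖) := by
          gcongr with j
          exact (real_inner_le_norm _ _).trans (by gcongr; exact hμ j)
      _ = _ := by rw [← Finset.sum_mul, hw', one_mul]
  · simp

end Mixture

/-! ### Comparison of the Hellinger distance with moments -/

section Comparison

open scoped InnerProductSpace

variable {d k : ℕ}

theorem smul_inv_smul_of_norm_le {E : Type*} [NormedAddCommGroup E] [NormedSpace ℝ E] {t : E}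
    {h : ℝ} (ht : ‖t‖ ≤ h) : h • (h⁻¹ • t) = t ∧ ‖h⁻¹ • t‖ ≤ 1 := by
  have hh0 : 0 ≤ h := (norm_nonneg _).trans ht
  rcases hh0.eq_or_lt with h0 | hpos
  · have : t = 0 := norm_le_zero_iff.1 (h0 ▸ ht)
    simp [this]
  · refine ⟨smul_inv_smul₀ hpos.ne' t, ?_⟩
    rw [norm_smul, norm_inv, Real.norm_of_nonneg hh0, inv_mul_le_iff₀ hpos, mul_one]
    exact ht

/-- The atoms of the signed measure `∑ j, w j • δ_{μ j} - ∑ j, w' j • δ_{μ' j}`. -/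
def diffAtom (μ μ' : Fin k → EuclideanSpace ℝ (Fin d)) : Fin k ⊕ Fin k → EuclideanSpace ℝ (Fin d) :=
  Sum.elim μ μ'

/-- The weights of the signed measure `∑ j, w j • δ_{μ j} - ∑ j, w' j • δ_{μ' j}`. -/
def diffWeight (w w' : Fin k → ℝ≥0) : Fin k ⊕ Fin k → ℝ :=
  Sum.elim (fun j => (w j : ℝ)) (fun j => -(w' j : ℝ))

theorem sum_diffWeight_mul (w w' : Fin k → ℝ≥0) (μ μ' : Fin k → EuclideanSpace ℝ (Fin d))
    (f : EuclideanSpace ℝ (Fin d) → ℂ) :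
    ∑ i, (diffWeight w w' i : ℂ) * f (diffAtom μ μ' i) =
      ∑ j, ((w j : ℝ) : ℂ) * f (μ j) - ∑ j, ((w' j : ℝ) : ℂ) * f (μ' j) := by
  rw [Fintype.sum_sum_type]
  simp [diffWeight, diffAtom, sub_eq_add_neg]

theorem norm_diffAtom_le {R : ℝ} {μ μ' : Fin k → EuclideanSpace ℝ (Fin d)}
    (hμ : ∀ j, ‖μ j‖ ≤ R) (hμ' : ∀ j, ‖μ' j‖ ≤ R) (i : Fin k ⊕ Fin k) :
    ‖diffAtom μ μ' i‖ ≤ R := by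
  rcases i with j | j
  · exact hμ j
  · exact hμ' j

/-- The constant bounding Laplace transforms by the Hellinger distance. -/
def laplaceConst (R : ℝ) : ℝ := 2 * Real.exp 128 * √(2 * Real.exp (32 * R + 512))

/-- The test function is a complex exponential. Its second moment involves `2u` of norm at most
`32`, hence `32R + 32²/2`, and the Gaussian factor is at least `exp(-16²/2)`. Neither depends on `d`
or `k`. -/
theorem norm_laplace_le_hellinger {R : ℝ} (hR : 0 ≤ R) {w w' : Fin k → ℝ≥0}
    {μ μ' : Fin k → EuclideanSpace ℝ (Fin d)} (hw : ∑ j, w j = 1) (hw' : ∑ j, w' j = 1)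
    (hμ : ∀ j, ‖μ j‖ ≤ R) (hμ' : ∀ j, ‖μ' j‖ ≤ R) {u v : EuclideanSpace ℝ (Fin d)}
    (hu : ‖u‖ ≤ 16) (hv : ‖v‖ ≤ 16) :
    ‖∑ i, (diffWeight w w' i : ℂ) * Complex.exp (cdot (diffAtom μ μ' i) u v)‖ ≤
      laplaceConst R * hellinger (mixture (∑ j, w j • Measure.dirac (μ j)))
        (mixture (∑ j, w' j • Measure.dirac (μ' j))) := by
  set P := mixture (∑ j, w j • Measure.dirac (μ j)) with hP
  set Q := mixture (∑ j, w' j • Measure.dirac (μ' j)) with hQ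
  have hPp : IsProbabilityMeasure P := isProbabilityMeasure_mixture hw μ
  have hQp : IsProbabilityMeasure Q := isProbabilityMeasure_mixture hw' μ'
  have hH : 0 ≤ hellinger P Q := hellinger_nonneg P Q
  have hsq : ∀ x : EuclideanSpace ℝ (Fin d), ‖Complex.exp (cdot x u v)‖ ^ 2 =
      Real.exp ⟪x, (2 : ℝ) • u⟫_ℝ := by
    intro x
    rw [norm_exp_cdot, ← Real.exp_nat_mul, inner_smul_right]
    norm_num
  have hiP := integrable_mixture_exp w μ ((2 : ℝ) • u)
  have hiQ := integrable_mixture_exp w' μ' ((2 : ℝ) • u)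
  have hmem : MemLp (fun x : EuclideanSpace ℝ (Fin d) => Complex.exp (cdot x u v)) 2 (P + Q) := by
    rw [memLp_two_iff_integrable_sq_norm (by fun_prop)]
    simp only [hsq]
    exact hiP.add_measure hiQ
  have h := norm_integral_sub_integral_le P Q hmem
  have h2u : ‖(2 : ℝ) • u‖ ≤ 32 := by
    rw [norm_smul]; norm_num; linarith
  have hbd : Real.exp (R * ‖(2 : ℝ) • u‖ + ‖(2 : ℝ) • u‖ ^ 2 / 2) ≤ Real.exp (32 * R + 512) := by
    apply Real.exp_le_exp.2
    have h1 : ‖(2 : ℝ) • u‖ ^ 2 ≤ 32 ^ 2 := by gcongr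
    nlinarith [norm_nonneg ((2 : ℝ) • u)]
  have hI : ∫ x, ‖Complex.exp (cdot x u v)‖ ^ 2 ∂(P + Q) ≤ 2 * Real.exp (32 * R + 512) := by
    simp only [hsq]
    rw [integral_add_measure hiP hiQ, two_mul]
    exact add_le_add ((integral_mixture_exp_le hw hμ _).trans hbd)
      ((integral_mixture_exp_le hw' hμ' _).trans hbd)
  rw [hP, hQ, integral_mixture_cexp, integral_mixture_cexp, ← sub_mul, norm_mul, ← hP, ← hQ] at h
  rw [sum_diffWeight_mul w w' μ μ' (fun x => Complex.exp (cdot x u v))]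
  have he : Real.exp (-128) ≤ ‖Complex.exp (((‖u‖ ^ 2 - ‖v‖ ^ 2) / 2 : ℝ) +
      (⟪u, v⟫_ℝ : ℂ) * Complex.I)‖ := by
    rw [Complex.norm_exp]
    apply Real.exp_le_exp.2
    simp only [Complex.add_re, Complex.ofReal_re, Complex.re_ofReal_mul, Complex.I_re, mul_zero,
      add_zero]
    have : ‖v‖ ^ 2 ≤ 16 ^ 2 := by gcongr
    nlinarith [sq_nonneg ‖u‖]
  set S := ‖∑ j, ((w j : ℝ) : ℂ) * Complex.exp (cdot (μ j) u v) -
    ∑ j, ((w' j : ℝ) : ℂ) * Complex.exp (cdot (μ' j) u v)‖ with hS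
  have h1 : S * Real.exp (-128) ≤ 2 * hellinger P Q * √(2 * Real.exp (32 * R + 512)) := by
    calc _ ≤ _ := mul_le_mul_of_nonneg_left he (norm_nonneg _)
      _ ≤ _ := h
      _ ≤ _ := by gcongr
  rw [Real.exp_neg, ← div_eq_mul_inv, div_le_iff₀ (Real.exp_pos _)] at h1
  refine h1.trans (le_of_eq ?_)
  rw [laplaceConst]
  ring

/-- Cauchy's estimate along the complex line through `u + iv`. Multiplication by a unit complex
number mixes `u` and `v`, which is why radius `8` here uses radius `16` for the Laplace transform.
-/
theorem norm_moment_le_hellinger {R : ℝ} (hR : 0 ≤ R) {w w' : Fin k → ℝ≥0}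
    {μ μ' : Fin k → EuclideanSpace ℝ (Fin d)} (hw : ∑ j, w j = 1) (hw' : ∑ j, w' j = 1)
    (hμ : ∀ j, ‖μ j‖ ≤ R) (hμ' : ∀ j, ‖μ' j‖ ≤ R) {u v : EuclideanSpace ℝ (Fin d)}
    (hu : ‖u‖ ≤ 8) (hv : ‖v‖ ≤ 8) (l : ℕ) :
    ‖∑ i, (diffWeight w w' i : ℂ) * cdot (diffAtom μ μ' i) u v ^ l‖ ≤
      l.factorial * (laplaceConst R * hellinger (mixture (∑ j, w j • Measure.dirac (μ j)))
        (mixture (∑ j, w' j • Measure.dirac (μ' j)))) := by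
  refine norm_sum_mul_pow_le_factorial _ _ (fun z hz => ?_) l
  simp only [cdot_mul]
  have hre : |z.re| ≤ 1 := hz ▸ Complex.abs_re_le_norm z
  have him : |z.im| ≤ 1 := hz ▸ Complex.abs_im_le_norm z
  have hs : ∀ (c : ℝ) (t : EuclideanSpace ℝ (Fin d)), |c| ≤ 1 → ‖t‖ ≤ 8 → ‖c • t‖ ≤ 8 := by
    intro c t hc ht
    rw [norm_smul, Real.norm_eq_abs]
    nlinarith [abs_nonneg c, norm_nonneg t]
  refine norm_laplace_le_hellinger hR hw hw' hμ hμ' ?_ ?_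
  · refine (norm_sub_le _ _).trans ?_
    linarith [hs z.re u hre hu, hs z.im v him hv]
  · refine (norm_add_le _ _).trans ?_
    linarith [hs z.re v hre hv, hs z.im u him hu]

/-- Schwarz's lemma along the complex segment joining the two directions. For `|τ| ≤ 3` the
directions have norm at most `1 + 3 + 3`, within the radius `8` where moments are of order `ε`. -/
theorem norm_moment_sub_moment_le {R ε : ℝ} (hR : 0 ≤ R) (hε : 0 < ε) {w w' : Fin k → ℝ≥0}
    {μ μ' : Fin k → EuclideanSpace ℝ (Fin d)} (hw : ∑ j, w j = 1) (hw' : ∑ j, w' j = 1)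
    (hμ : ∀ j, ‖μ j‖ ≤ R) (hμ' : ∀ j, ‖μ' j‖ ≤ R)
    (hH : hellinger (mixture (∑ j, w j • Measure.dirac (μ j)))
        (mixture (∑ j, w' j • Measure.dirac (μ' j))) ≤ ε)
    {u v u' v' : EuclideanSpace ℝ (Fin d)} (hu' : ‖u'‖ ≤ 1) (hv' : ‖v'‖ ≤ 1)
    {h : ℝ} (hh2 : h ≤ 2) (hhu : ‖u - u'‖ ≤ h) (hhv : ‖v - v'‖ ≤ h) (l : ℕ) :
    ‖∑ i, (diffWeight w w' i : ℂ) * cdot (diffAtom μ μ' i) u v ^ l -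
      ∑ i, (diffWeight w w' i : ℂ) * cdot (diffAtom μ μ' i) u' v' ^ l‖ ≤
      l.factorial * (laplaceConst R * ε) * h := by
  have hL : 0 < laplaceConst R := by unfold laplaceConst; positivity
  have hh0 : 0 ≤ h := (norm_nonneg _).trans hhu
  obtain ⟨hu1, hu2⟩ := smul_inv_smul_of_norm_le hhu
  obtain ⟨hv1, hv2⟩ := smul_inv_smul_of_norm_le hhv
  set du := h⁻¹ • (u - u')
  set dv := h⁻¹ • (v - v')
  have key : ∀ x, cdot x u v = cdot x u' v' + h * cdot x du dv := by
    intro x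
    rw [← cdot_smul_right, cdot_add, hu1, hv1]
    simp
  simp only [key]
  refine norm_sum_mul_add_pow_sub_le _ _ _ l (by positivity) hh0 hh2 (fun τ hτ => ?_)
  have key2 : ∀ x, cdot x u' v' + τ * cdot x du dv =
      cdot x (u' + (τ.re • du - τ.im • dv)) (v' + (τ.re • dv + τ.im • du)) := by
    intro x
    rw [mul_comm, cdot_mul, cdot_add]
  simp only [key2]
  have hre : |τ.re| ≤ 3 := (Complex.abs_re_le_norm τ).trans hτ
  have him : |τ.im| ≤ 3 := (Complex.abs_im_le_norm τ).trans hτ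
  have hs : ∀ (c : ℝ) (t : EuclideanSpace ℝ (Fin d)), |c| ≤ 3 → ‖t‖ ≤ 1 → ‖c • t‖ ≤ 3 := by
    intro c t hc ht
    rw [norm_smul, Real.norm_eq_abs]
    nlinarith [abs_nonneg c, norm_nonneg t]
  refine (norm_moment_le_hellinger hR hw hw' hμ hμ' ?_ ?_ l).trans (by gcongr)
  · refine (norm_add_le _ _).trans ?_
    have := norm_sub_le (τ.re • du) (τ.im • dv)
    linarith [hs τ.re du hre hu2, hs τ.im dv him hv2]
  · refine (norm_add_le _ _).trans ?_
    have := norm_add_le (τ.re • dv) (τ.im • du)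
    linarith [hs τ.re dv hre hv2, hs τ.im du him hu2]

/-- Jensen's inequality. It dominates a single exponential by the mixture density, and with that
exponential as the weight the `L²` integrals become explicit. -/
theorem exp_inner_mean_le_mixDensity {R : ℝ} {w : Fin k → ℝ≥0}
    {μ : Fin k → EuclideanSpace ℝ (Fin d)} (hw : ∑ j, w j = 1) (hμ : ∀ j, ‖μ j‖ ≤ R)
    (x : EuclideanSpace ℝ (Fin d)) :
    Real.exp ⟪x, ∑ j, (w j : ℝ) • μ j⟫_ℝ ≤ Real.exp (R ^ 2 / 2) * mixDensity w μ x := by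
  have hw' : ∑ j, (w j : ℝ) = 1 := by exact_mod_cast hw
  rw [inner_sum]
  simp only [inner_smul_right]
  have h := convexOn_exp.map_sum_le (t := Finset.univ) (w := fun j => (w j : ℝ))
    (p := fun j => ⟪x, μ j⟫_ℝ) (fun j _ => (w j).2) hw' (fun j _ => Set.mem_univ _)
  simp only [smul_eq_mul] at h
  refine h.trans ?_
  rw [mixDensity, Finset.mul_sum]
  refine Finset.sum_le_sum fun j _ => ?_
  rw [shiftDensity, mul_left_comm, ← Real.exp_add]
  gcongr
  have : ‖μ j‖ ^ 2 ≤ R ^ 2 := by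
    have := hμ j
    gcongr
  linarith

/-- Expanding the square leaves Gaussian Laplace transforms. Completing squares shows that the
weight merely recentres the atoms at `m`. -/
theorem integral_sum_shiftDensity_sq {ι E : Type*} [Fintype ι] [NormedAddCommGroup E]
    [InnerProductSpace ℝ E] [FiniteDimensional ℝ E] [MeasurableSpace E] [BorelSpace E]
    (a : ι → ℝ) (x : ι → E) (m : E) :
    Integrable (fun z => (∑ i, a i * shiftDensity (x i) z) ^ 2 / Real.exp ⟪z, m⟫_ℝ)
      (stdGaussian E) ∧
    ∫ z, (∑ i, a i * shiftDensity (x i) z) ^ 2 / Real.exp ⟪z, m⟫_ℝ ∂(stdGaussian E) =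
      Real.exp (-(‖m‖ ^ 2 / 2)) * ∑ i, ∑ j, a i * a j * Real.exp ⟪x i - m, x j - m⟫_ℝ := by
  have hpt : ∀ z, (∑ i, a i * shiftDensity (x i) z) ^ 2 / Real.exp ⟪z, m⟫_ℝ =
      ∑ i, ∑ j, a i * a j * Real.exp (-(‖x i‖ ^ 2 / 2) - ‖x j‖ ^ 2 / 2) *
        Real.exp ⟪z, x i + x j - m⟫_ℝ := by
    intro z
    rw [sq, Finset.sum_mul_sum, Finset.sum_div]
    refine Finset.sum_congr rfl fun i _ => ?_
    rw [Finset.sum_div]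
    refine Finset.sum_congr rfl fun j _ => ?_
    have he : shiftDensity (x i) z * shiftDensity (x j) z / Real.exp ⟪z, m⟫_ℝ =
        Real.exp (-(‖x i‖ ^ 2 / 2) - ‖x j‖ ^ 2 / 2) * Real.exp ⟪z, x i + x j - m⟫_ℝ := by
      rw [shiftDensity, shiftDensity, ← Real.exp_add, ← Real.exp_sub, ← Real.exp_add,
        inner_sub_right, inner_add_right]
      congr 1
      ring
    rw [mul_mul_mul_comm, mul_div_assoc, he, mul_assoc (a i * a j)]
  simp only [hpt]
  have hi : ∀ i j, Integrable (fun z => a i * a j *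
      Real.exp (-(‖x i‖ ^ 2 / 2) - ‖x j‖ ^ 2 / 2) * Real.exp ⟪z, x i + x j - m⟫_ℝ)
      (stdGaussian E) := fun i j => (integrable_exp_inner _).const_mul _
  refine ⟨integrable_finsetSum _ fun i _ => integrable_finsetSum _ fun j _ => hi i j, ?_⟩
  rw [integral_finsetSum _ fun i _ => integrable_finsetSum _ fun j _ => hi i j, Finset.mul_sum]
  refine Finset.sum_congr rfl fun i _ => ?_
  rw [integral_finsetSum _ fun j _ => hi i j, Finset.mul_sum]
  refine Finset.sum_congr rfl fun j _ => ?_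
  rw [integral_const_mul, integral_exp_inner, mul_assoc, mul_left_comm (Real.exp (-(‖m‖ ^ 2 / 2))),
    ← Real.exp_add, ← Real.exp_add]
  congr 2
  rw [norm_sub_sq_real, norm_add_sq_real]
  simp only [inner_sub_left, inner_sub_right, inner_add_left, real_inner_self_eq_norm_sq]
  rw [real_inner_comm (x j) m]
  ring

/-- The constant bounding the Hellinger distance by moments. -/
def momentConst (R : ℝ) (k : ℕ) : ℝ :=
  Real.exp (R ^ 2 / 2) * (2 * Real.exp ((2 * (1 + 5 * R)) ^ 2 / 2)) ^ (k + k)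

/-- Moments bound the Laplace transform; its second moment under a complex Gaussian vector is the
Gram sum, which equals the weighted `L²` distance up to a factor at most `1`, and this dominates the
squared Hellinger distance. -/
theorem hellinger_le_moment {R M : ℝ} (hR : 0 ≤ R) (hM : 0 ≤ M) {w w' : Fin k → ℝ≥0}
    {μ μ' : Fin k → EuclideanSpace ℝ (Fin d)} (hw : ∑ j, w j = 1) (hw' : ∑ j, w' j = 1)
    (hμ : ∀ j, ‖μ j‖ ≤ R) (hμ' : ∀ j, ‖μ' j‖ ≤ R)
    (hmom : ∀ u v : EuclideanSpace ℝ (Fin d), ‖u‖ ≤ 1 → ‖v‖ ≤ 1 → ∀ l < k + k,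
      ‖∑ i, (diffWeight w w' i : ℂ) * cdot (diffAtom μ μ' i) u v ^ l‖ ≤ M) :
    hellinger (mixture (∑ j, w j • Measure.dirac (μ j)))
        (mixture (∑ j, w' j • Measure.dirac (μ' j))) ≤ momentConst R k * M := by
  set P := mixture (∑ j, w j • Measure.dirac (μ j)) with hP
  set Q := mixture (∑ j, w' j • Measure.dirac (μ' j)) with hQ
  have hPp : IsProbabilityMeasure P := isProbabilityMeasure_mixture hw μ
  have hQp : IsProbabilityMeasure Q := isProbabilityMeasure_mixture hw' μ'
  set a := diffWeight w w' with ha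
  set x := diffAtom μ μ' with hx
  have hxR : ∀ i, ‖x i‖ ≤ R := norm_diffAtom_le hμ hμ'
  have hLap : ∀ u v : EuclideanSpace ℝ (Fin d),
      ‖∑ i, (a i : ℂ) * Complex.exp (cdot (x i) u v)‖ ≤
        M * Real.exp ((1 + 2 * (2 * R)) * (‖u‖ + ‖v‖)) := by
    intro u v
    set r := ‖u‖ + ‖v‖ with hr
    have hr0 : 0 ≤ r := by positivity
    obtain ⟨hu1, hu2⟩ := smul_inv_smul_of_norm_le (t := u) (h := r) (by linarith [norm_nonneg v])
    obtain ⟨hv1, hv2⟩ := smul_inv_smul_of_norm_le (t := v) (h := r) (by linarith [norm_nonneg u])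
    have key : ∀ i, cdot (x i) u v = r * cdot (x i) (r⁻¹ • u) (r⁻¹ • v) := by
      intro i
      rw [← cdot_smul_right, hu1, hv1]
    simp only [key]
    refine norm_sum_mul_exp_le _ _ hM (by positivity) hr0 (fun i => ?_) (fun l hl => ?_)
    · refine (norm_cdot_le _ _ _).trans ?_
      nlinarith [hxR i, norm_nonneg (x i), norm_nonneg (r⁻¹ • u), norm_nonneg (r⁻¹ • v)]
    · exact hmom _ _ hu2 hv2 l (by simpa using hl)
  set m := ∑ j, (w' j : ℝ) • μ' j with hm
  have hw'r : ∑ j, (w' j : ℝ) = 1 := by exact_mod_cast hw'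
  have hmR : ‖m‖ ≤ R := by
    refine (norm_sum_le _ _).trans ?_
    calc ∑ j, ‖(w' j : ℝ) • μ' j‖ ≤ ∑ j, (w' j : ℝ) * R := by
          refine Finset.sum_le_sum fun j _ => ?_
          rw [norm_smul, Real.norm_of_nonneg (NNReal.coe_nonneg (w' j))]
          have := hμ' j
          gcongr
      _ = R := by rw [← Finset.sum_mul, hw'r, one_mul]
  -- Only the Gram matrix of the `2k` recentred atoms matters, so they can be moved isometrically
  -- into dimension `2k`. This removes `d` from the constant.
  obtain ⟨b, -, -, hb, hrep⟩ := exists_frame (n := k + k) (by simp) (fun i => x i - m)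
  have hinner : ∀ i j, ⟪analysis b (x i - m), analysis b (x j - m)⟫_ℝ = ⟪x i - m, x j - m⟫_ℝ := by
    intro i j
    rw [inner_analysis, ← hrep]
  have hGram := sum_mul_exp_inner_le (n := k + k) a (fun i => analysis b (x i - m)) (M := M)
    -- The growth rate is `1 + 4R` from the Laplace bound plus `R` from recentring at `m`.
    (c := 1 + 5 * R) hM (by positivity) (fun u v => by
      have h1 : ∀ i, Complex.exp (cdot (analysis b (x i - m)) u v) =
          Complex.exp (cdot (x i) (synthesis b u) (synthesis b v)) *
            Complex.exp (cdot m (-synthesis b u) (-synthesis b v)) := by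
        intro i
        rw [← Complex.exp_add]
        congr 1
        simp only [cdot, inner_analysis]
        apply Complex.ext <;> simp [inner_sub_left] <;> ring
      simp only [h1, ← mul_assoc, ← Finset.sum_mul]
      rw [norm_mul, norm_exp_cdot]
      have h2 : ⟪m, -synthesis b u⟫_ℝ ≤ R * (‖u‖ + ‖v‖) := by
        refine (real_inner_le_norm _ _).trans ?_
        rw [norm_neg]
        have := hb u
        calc ‖m‖ * ‖synthesis b u‖ ≤ R * ‖u‖ := by gcongr
          _ ≤ _ := by gcongr; linarith [norm_nonneg v]
      calc _ ≤ M * Real.exp ((1 + 2 * (2 * R)) * (‖u‖ + ‖v‖)) *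
            Real.exp (R * (‖u‖ + ‖v‖)) := by
            gcongr
            refine (hLap _ _).trans ?_
            have := hb u
            have := hb v
            gcongr
        _ = _ := by
            rw [mul_assoc, ← Real.exp_add]
            congr 2
            ring)
  simp only [hinner] at hGram
  obtain ⟨hTi, hTv⟩ := integral_sum_shiftDensity_sq a x m
  have hdiff : ∀ z, ∑ i, a i * shiftDensity (x i) z = mixDensity w μ z - mixDensity w' μ' z := by
    intro z
    rw [Fintype.sum_sum_type]
    simp [ha, hx, diffWeight, diffAtom, sub_eq_add_neg, mixDensity]
  simp only [hdiff] at hTi hTv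
  have hmain := hellinger_sq_le_of_withDensity P Q
    (γ := stdGaussian (EuclideanSpace ℝ (Fin d))) (g₁ := mixDensity w μ) (g₂ := mixDensity w' μ')
    (W := fun z => Real.exp ⟪z, m⟫_ℝ) (c := Real.exp (R ^ 2 / 2)) (Real.exp_pos _).le
    (by fun_prop) (by fun_prop) (by fun_prop) (mixDensity_nonneg _ _) (mixDensity_nonneg _ _)
    (integrable_mixDensity _ _) (integrable_mixDensity _ _) (mixture_eq_withDensity _ _)
    (mixture_eq_withDensity _ _) (fun z => Real.exp_pos _)
    (exp_inner_mean_le_mixDensity hw' hμ') hTi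
  rw [hTv] at hmain
  refine abs_le_of_sq_le_sq' ?_ (by unfold momentConst; positivity) |>.2
  set B := (2 * Real.exp ((2 * (1 + 5 * R)) ^ 2 / 2)) ^ (k + k) with hB
  have hexp1 : 1 ≤ Real.exp (R ^ 2 / 2) := Real.one_le_exp (by positivity)
  calc hellinger P Q ^ 2 ≤ _ := hmain
    _ ≤ Real.exp (R ^ 2 / 2) * (1 * (M ^ 2 * B ^ 2)) := by
        gcongr ?_ * ?_
        calc _ ≤ Real.exp (-(‖m‖ ^ 2 / 2)) * (M ^ 2 * B ^ 2) := by gcongr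
          _ ≤ _ := by
            gcongr
            exact Real.exp_le_one_iff.2 (by
              have := sq_nonneg ‖m‖
              linarith)
    _ ≤ Real.exp (R ^ 2 / 2) ^ 2 * (M ^ 2 * B ^ 2) := by
        rw [one_mul]
        gcongr
        exact le_self_pow₀ hexp1 two_ne_zero
    _ = (momentConst R k * M) ^ 2 := by rw [momentConst, ← hB]; ring

end Comparison

/-! ### A finite-dimensional space of moment functions -/

section MomentSpace

open scoped InnerProductSpace

/-- Pairs of vectors of the unit ball of `ℝⁿ` together with a degree less than `n`. -/
abbrev MomentDomain (n : ℕ) : Type :=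
  Metric.closedBall (0 : EuclideanSpace ℝ (Fin n)) 1 ×
    Metric.closedBall (0 : EuclideanSpace ℝ (Fin n)) 1 × Fin n

instance (n : ℕ) : CompactSpace (Metric.closedBall (0 : EuclideanSpace ℝ (Fin n)) 1) :=
  isCompact_iff_compactSpace.1 (isCompact_closedBall _ _)

/-- The monomials in the `n` complex variables `s j + i s' j` of degree less than `n`. -/
def monomialFun {n : ℕ} (p : Σ l : Fin n, (Fin l → Fin n)) : C(MomentDomain n, ℂ) where
  toFun s := (if s.2.2 = p.1 then 1 else 0) *
    ∏ j, (((s.1 : EuclideanSpace ℝ (Fin n)) (p.2 j) : ℂ) +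
      ((s.2.1 : EuclideanSpace ℝ (Fin n)) (p.2 j) : ℂ) * Complex.I)
  continuous_toFun := by
    have h1 : Continuous fun s : MomentDomain n => (if s.2.2 = p.1 then 1 else 0 : ℂ) :=
      (continuous_of_discreteTopology (f := fun l : Fin n => (if l = p.1 then 1 else 0 : ℂ))).comp
        (continuous_snd.comp continuous_snd)
    refine h1.mul (continuous_finsetProd _ fun j _ => ?_)
    fun_prop

/-- The real span of the monomials of degree less than `n`. -/
def momentSpace (n : ℕ) : Submodule ℝ C(MomentDomain n, ℂ) :=
  Submodule.span ℝ (Set.range (monomialFun (n := n)))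

instance (n : ℕ) : FiniteDimensional ℝ (momentSpace n) :=
  FiniteDimensional.span_of_finite ℝ (Set.finite_range _)

theorem finrank_momentSpace_le (n : ℕ) : Module.finrank ℝ (momentSpace n) ≤ n ^ n := by
  refine (finrank_range_le_card _).trans ?_
  -- Monomials are indexed by words, with repetitions under commutation; the crude count of words of
  -- length below `n` suffices.
  rw [Fintype.card_sigma]
  simp only [Fintype.card_fun, Fintype.card_fin]
  rw [Fin.sum_univ_eq_sum_range (fun l => n ^ l) n]
  rcases Nat.lt_or_ge n 2 with h | h
  · interval_cases n <;> simp
  · exact (Nat.geomSum_lt h (fun k hk => Finset.mem_range.1 hk)).le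

/-- The moments of the signed measure `∑ i, a i • δ_{z i}`, as an element of `momentSpace n`. -/
def momentFun {ι : Type*} [Fintype ι] {n : ℕ} (a : ι → ℝ) (z : ι → EuclideanSpace ℝ (Fin n)) :
    momentSpace n :=
  ⟨∑ p, (∑ i, a i * ∏ j, z i (p.2 j)) • monomialFun p,
    Submodule.sum_mem _ fun p _ => Submodule.smul_mem _ _ (Submodule.subset_span ⟨p, rfl⟩)⟩

/-- Expansion of a power of a sum over words. Thus a moment function depends linearly on the
finitely many tensor moments of the signed measure. -/
theorem momentFun_apply {ι : Type*} [Fintype ι] {n : ℕ} (a : ι → ℝ)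
    (z : ι → EuclideanSpace ℝ (Fin n)) (s : MomentDomain n) :
    (momentFun a z : C(MomentDomain n, ℂ)) s =
      ∑ i, (a i : ℂ) * cdot (z i) s.1 s.2.1 ^ (s.2.2 : ℕ) := by
  obtain ⟨s, s', l⟩ := s
  have hc : ∀ i, cdot (z i) (s : EuclideanSpace ℝ (Fin n)) s' =
      ∑ j, (z i j : ℂ) * (((s : EuclideanSpace ℝ (Fin n)) j : ℂ) +
        ((s' : EuclideanSpace ℝ (Fin n)) j : ℂ) * Complex.I) := by
    intro i
    apply Complex.ext <;> simp [cdot, PiLp.inner_apply, mul_comm]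
  simp only [hc]
  simp only [momentFun, ContinuousMap.coe_sum, Finset.sum_apply, ContinuousMap.coe_smul,
    Pi.smul_apply, monomialFun, ContinuousMap.coe_mk]
  rw [Fintype.sum_sigma, Finset.sum_eq_single l]
  · simp only [if_true, one_mul, Complex.real_smul, Complex.ofReal_sum, Complex.ofReal_mul,
      Complex.ofReal_prod, Finset.sum_mul]
    rw [Finset.sum_comm]
    refine Finset.sum_congr rfl fun i _ => ?_
    rw [Fintype.sum_pow, Finset.mul_sum]
    refine Finset.sum_congr rfl fun p _ => ?_
    rw [mul_assoc, ← Finset.prod_mul_distrib]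
  · intro l' _ hl'
    simp [hl'.symm]
  · simp

theorem norm_analysis_sub_le {E : Type*} [NormedAddCommGroup E] [InnerProductSpace ℝ E] {n : ℕ}
    (b b' : Fin n → E) (t : E) (ht : ‖t‖ ≤ 1) :
    ‖analysis b t - analysis b' t‖ ≤ n * ‖b - b'‖ := by
  have h1 : ‖analysis b t - analysis b' t‖ ≤ ∑ j, ‖(analysis b t - analysis b' t) j‖ := by
    rw [EuclideanSpace.norm_eq]
    refine Real.sqrt_le_iff.2 ⟨by positivity, ?_⟩
    exact Finset.sum_sq_le_sq_sum_of_nonneg (fun j _ => norm_nonneg _)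
  refine h1.trans ?_
  calc _ ≤ ∑ _j : Fin n, ‖b - b'‖ := by
        refine Finset.sum_le_sum fun j _ => ?_
        have : (analysis b t - analysis b' t) j = ⟪(b - b') j, t⟫_ℝ := by
          simp [analysis, inner_sub_left]
        rw [this]
        refine (norm_inner_le_norm _ _).trans ?_
        have := norm_le_pi_norm (b - b') j
        nlinarith [norm_nonneg ((b - b') j), norm_nonneg t]
    _ = _ := by simp

theorem synthesis_sub {E : Type*} [NormedAddCommGroup E] [InnerProductSpace ℝ E] {n : ℕ}
    (b : Fin n → E) (s t : EuclideanSpace ℝ (Fin n)) :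
    synthesis b s - synthesis b t = synthesis b (s - t) := by
  simp [synthesis, sub_smul]

theorem cdot_analysis {E : Type*} [NormedAddCommGroup E] [InnerProductSpace ℝ E] {n : ℕ}
    (b : Fin n → E) (x : E) (s t : EuclideanSpace ℝ (Fin n)) :
    cdot (analysis b x) s t = cdot x (synthesis b s) (synthesis b t) := by
  simp [cdot, inner_analysis]

end MomentSpace

/-! ### Covering -/

section Covering

open scoped InnerProductSpace

variable {d k : ℕ}

/-- A representation of a mixture in the Hellinger ball around `∑ j, w₀ j • N(μ₀ j, I)` together
with a frame of the span of the atoms. -/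
structure IsFramed (R ε : ℝ) (w₀ : Fin k → ℝ≥0) (μ₀ : Fin k → EuclideanSpace ℝ (Fin d))
    (P : Measure (EuclideanSpace ℝ (Fin d))) (w : Fin k → ℝ≥0)
    (μ : Fin k → EuclideanSpace ℝ (Fin d)) (b : Fin (k + k) → EuclideanSpace ℝ (Fin d)) :
    Prop where
  sum_eq_one : ∑ j, w j = 1
  norm_le : ∀ j, ‖μ j‖ ≤ R
  eq_mixture : P = mixture (∑ j, w j • Measure.dirac (μ j))
  hellinger_le : hellinger (mixture (∑ j, w j • Measure.dirac (μ j)))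
    (mixture (∑ j, w₀ j • Measure.dirac (μ₀ j))) ≤ ε
  frame_norm_le : ∀ j, ‖b j‖ ≤ 1
  norm_analysis_le : ∀ t, ‖analysis b t‖ ≤ ‖t‖
  norm_synthesis_le : ∀ s, ‖synthesis b s‖ ≤ ‖s‖
  inner_eq : ∀ i t, ⟪diffAtom μ μ₀ i, t⟫_ℝ =
    ⟪diffAtom μ μ₀ i, synthesis b (analysis b t)⟫_ℝ

/-- The moments of the difference to the centre, in the coordinates of the frame. -/
def framedMoments (w₀ : Fin k → ℝ≥0) (μ₀ : Fin k → EuclideanSpace ℝ (Fin d)) (w : Fin k → ℝ≥0)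
    (μ : Fin k → EuclideanSpace ℝ (Fin d)) (b : Fin (k + k) → EuclideanSpace ℝ (Fin d)) :
    momentSpace (k + k) :=
  momentFun (diffWeight w w₀) (fun i => analysis b (diffAtom μ μ₀ i))

variable {R ε : ℝ} {w₀ : Fin k → ℝ≥0} {μ₀ : Fin k → EuclideanSpace ℝ (Fin d)}

/-- The bound for the moments of the differences of mixtures in a Hellinger ball. -/
def momentBound (R ε : ℝ) (k : ℕ) : ℝ := (k + k).factorial * (laplaceConst R * ε)

theorem laplaceConst_pos (R : ℝ) : 0 < laplaceConst R := by unfold laplaceConst; positivity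

theorem momentBound_pos (R : ℝ) (hε : 0 < ε) (k : ℕ) : 0 < momentBound R ε k := by
  have := laplaceConst_pos R
  unfold momentBound; positivity

theorem factorial_mul_le_momentBound (R : ℝ) (hε : 0 < ε) {l : ℕ} (hl : l < k + k) :
    l.factorial * (laplaceConst R * ε) ≤ momentBound R ε k := by
  have := laplaceConst_pos R
  unfold momentBound
  gcongr

/-- This is where locality enters: membership in the Hellinger ball confines the moment parameters
to a ball of radius proportional to `ε`. -/
theorem norm_framedMoments_le (hR : 0 ≤ R) (hε : 0 < ε) (hw₀ : ∑ j, w₀ j = 1)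
    (hμ₀ : ∀ j, ‖μ₀ j‖ ≤ R) {P : Measure (EuclideanSpace ℝ (Fin d))} {w : Fin k → ℝ≥0}
    {μ : Fin k → EuclideanSpace ℝ (Fin d)} {b : Fin (k + k) → EuclideanSpace ℝ (Fin d)}
    (h : IsFramed R ε w₀ μ₀ P w μ b) :
    ‖framedMoments w₀ μ₀ w μ b‖ ≤ momentBound R ε k := by
  rw [← Submodule.norm_coe, ContinuousMap.norm_le _ (momentBound_pos R hε k).le]
  rintro ⟨⟨s, hs⟩, ⟨s', hs'⟩, l⟩
  rw [framedMoments, momentFun_apply]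
  simp only [cdot_analysis]
  rw [mem_closedBall_zero_iff] at hs hs'
  have hL := laplaceConst_pos R
  refine (norm_moment_le_hellinger hR h.sum_eq_one hw₀ h.norm_le hμ₀ ?_ ?_ l).trans ?_
  · linarith [h.norm_synthesis_le s]
  · linarith [h.norm_synthesis_le s']
  · refine le_trans ?_ (factorial_mul_le_momentBound R hε l.2)
    have := h.hellinger_le
    gcongr

/-- The difference splits through the centre `Γ₀`. Both moment functions are evaluated at the
coordinates of `u`, `v` in the first frame `b`; for the second measure this is the wrong point, and
correcting it moves the direction by at most a multiple of `‖b - b'‖`. -/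
theorem norm_moment_sub_le_framed (hR : 0 ≤ R) (hε : 0 < ε) (hw₀ : ∑ j, w₀ j = 1)
    (hμ₀ : ∀ j, ‖μ₀ j‖ ≤ R) {P P' : Measure (EuclideanSpace ℝ (Fin d))} {w w' : Fin k → ℝ≥0}
    {μ μ' : Fin k → EuclideanSpace ℝ (Fin d)} {b b' : Fin (k + k) → EuclideanSpace ℝ (Fin d)}
    (h : IsFramed R ε w₀ μ₀ P w μ b) (h' : IsFramed R ε w₀ μ₀ P' w' μ' b')
    {u v : EuclideanSpace ℝ (Fin d)} (hu : ‖u‖ ≤ 1) (hv : ‖v‖ ≤ 1) {l : ℕ} (hl : l < k + k) :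
    ‖∑ i, (diffWeight w w' i : ℂ) * cdot (diffAtom μ μ' i) u v ^ l‖ ≤
      ‖framedMoments w₀ μ₀ w μ b - framedMoments w₀ μ₀ w' μ' b'‖ +
        momentBound R ε k * ((k + k : ℕ) * ‖b - b'‖) := by
  have hB := momentBound_pos R hε k
  have eval : ∀ {P} {w : Fin k → ℝ≥0} {μ : Fin k → EuclideanSpace ℝ (Fin d)} {b},
      IsFramed R ε w₀ μ₀ P w μ b → ∀ i,
      cdot (diffAtom μ μ₀ i) u v =
        cdot (diffAtom μ μ₀ i) (synthesis b (analysis b u)) (synthesis b (analysis b v)) := by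
    intro P w μ b h i
    simp only [cdot]
    rw [h.inner_eq i u, h.inner_eq i v]
  have hau := (h.norm_analysis_le u).trans hu
  have hav := (h.norm_analysis_le v).trans hv
  have hau' := (h'.norm_analysis_le u).trans hu
  have hav' := (h'.norm_analysis_le v).trans hv
  let s : MomentDomain (k + k) := (⟨analysis b u, mem_closedBall_zero_iff.2 hau⟩,
    ⟨analysis b v, mem_closedBall_zero_iff.2 hav⟩, ⟨l, hl⟩)
  have h1 : ∑ i, (diffWeight w w' i : ℂ) * cdot (diffAtom μ μ' i) u v ^ l =
      ∑ i, (diffWeight w w₀ i : ℂ) * cdot (diffAtom μ μ₀ i) u v ^ l -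
      ∑ i, (diffWeight w' w₀ i : ℂ) * cdot (diffAtom μ' μ₀ i) u v ^ l := by
    rw [sum_diffWeight_mul w w' μ μ' (fun x => cdot x u v ^ l),
      sum_diffWeight_mul w w₀ μ μ₀ (fun x => cdot x u v ^ l),
      sum_diffWeight_mul w' w₀ μ' μ₀ (fun x => cdot x u v ^ l)]
    ring
  have h2 : ∑ i, (diffWeight w w₀ i : ℂ) * cdot (diffAtom μ μ₀ i) u v ^ l =
      (framedMoments w₀ μ₀ w μ b : C(MomentDomain (k + k), ℂ)) s := by
    rw [framedMoments, momentFun_apply]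
    simp only [cdot_analysis, s]
    simp only [← eval h]
  have h3 : (framedMoments w₀ μ₀ w' μ' b' : C(MomentDomain (k + k), ℂ)) s =
      ∑ i, (diffWeight w' w₀ i : ℂ) * cdot (diffAtom μ' μ₀ i)
        (synthesis b' (analysis b u)) (synthesis b' (analysis b v)) ^ l := by
    rw [framedMoments, momentFun_apply]
    simp only [cdot_analysis, s]
  have h4 : ‖(framedMoments w₀ μ₀ w μ b : C(MomentDomain (k + k), ℂ)) s -
      (framedMoments w₀ μ₀ w' μ' b' : C(MomentDomain (k + k), ℂ)) s‖ ≤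
      ‖framedMoments w₀ μ₀ w μ b - framedMoments w₀ μ₀ w' μ' b'‖ := by
    rw [← Submodule.norm_coe, Submodule.coe_sub]
    exact ContinuousMap.norm_coe_le_norm ((framedMoments w₀ μ₀ w μ b :
      C(MomentDomain (k + k), ℂ)) - (framedMoments w₀ μ₀ w' μ' b' : C(MomentDomain (k + k), ℂ))) s
  -- The minimum with `2` keeps the displacement within the range of Schwarz's lemma even when the
  -- frames are far apart.
  have hsub : ∀ t, ‖t‖ ≤ 1 → ‖synthesis b' (analysis b t) - synthesis b' (analysis b' t)‖ ≤
      min ((k + k : ℕ) * ‖b - b'‖) 2 := by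
    intro t ht
    rw [synthesis_sub]
    refine (h'.norm_synthesis_le _).trans (le_min (norm_analysis_sub_le b b' t ht) ?_)
    refine (norm_sub_le _ _).trans ?_
    linarith [h.norm_analysis_le t, h'.norm_analysis_le t]
  have h5 := norm_moment_sub_moment_le hR hε h'.sum_eq_one hw₀ h'.norm_le hμ₀ h'.hellinger_le
    (u := synthesis b' (analysis b u)) (v := synthesis b' (analysis b v))
    (u' := synthesis b' (analysis b' u)) (v' := synthesis b' (analysis b' v))
    ((h'.norm_synthesis_le _).trans hau') ((h'.norm_synthesis_le _).trans hav')
    (min_le_right _ _) (hsub u hu) (hsub v hv) l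
  have h6 : l.factorial * (laplaceConst R * ε) * min ((k + k : ℕ) * ‖b - b'‖) 2 ≤
      momentBound R ε k * ((k + k : ℕ) * ‖b - b'‖) := by
    have := factorial_mul_le_momentBound (k := k) R hε hl
    refine mul_le_mul this (min_le_left _ _) (le_min (by positivity) (by norm_num)) hB.le
  rw [← h3] at h5
  simp only [← eval h'] at h5
  rw [h1, h2]
  refine (norm_sub_le_norm_sub_add_norm_sub _ _ _).trans (add_le_add h4 (h5.trans h6))

theorem hellinger_le_framed (hR : 0 ≤ R) (hε : 0 < ε) (hw₀ : ∑ j, w₀ j = 1)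
    (hμ₀ : ∀ j, ‖μ₀ j‖ ≤ R) {P P' : Measure (EuclideanSpace ℝ (Fin d))} {w w' : Fin k → ℝ≥0}
    {μ μ' : Fin k → EuclideanSpace ℝ (Fin d)} {b b' : Fin (k + k) → EuclideanSpace ℝ (Fin d)}
    (h : IsFramed R ε w₀ μ₀ P w μ b) (h' : IsFramed R ε w₀ μ₀ P' w' μ' b') :
    hellinger P P' ≤ momentConst R k *
      (‖framedMoments w₀ μ₀ w μ b - framedMoments w₀ μ₀ w' μ' b'‖ +
        momentBound R ε k * ((k + k : ℕ) * ‖b - b'‖)) := by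
  have hB := momentBound_pos R hε k
  rw [h.eq_mixture, h'.eq_mixture]
  exact hellinger_le_moment hR (by positivity) h.sum_eq_one h'.sum_eq_one h.norm_le h'.norm_le
    fun u v hu hv l hl => norm_moment_sub_le_framed hR hε hw₀ hμ₀ h h' hu hv hl

theorem exists_isFramed {P : Measure (EuclideanSpace ℝ (Fin d))}
    (hP : P ∈ hellingerBall R k d ε (∑ j, w₀ j • Measure.dirac (μ₀ j))) :
    ∃ w μ b, IsFramed R ε w₀ μ₀ P w μ b := by
  obtain ⟨Γ, ⟨w, μ, hw, hμ, rfl⟩, rfl, hH⟩ := hP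
  obtain ⟨b, hb1, hb2, hb3, hb4⟩ := exists_frame (n := k + k) (by simp) (diffAtom μ μ₀)
  exact ⟨w, μ, b, hw, hμ, rfl, hH, hb1, hb2, hb3, hb4⟩

/-- Covering of a Hellinger ball by Hellinger balls, with explicit constants. -/
theorem exists_cover_hellingerBall (hR : 0 ≤ R) (hε : 0 < ε) {δ : ℝ} (hδ : 0 < δ) (hk : 1 ≤ k)
    (hw₀ : ∑ j, w₀ j = 1) (hμ₀ : ∀ j, ‖μ₀ j‖ ≤ R) :
    ∃ C : Finset (Measure (EuclideanSpace ℝ (Fin d))),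
      (C : Set (Measure (EuclideanSpace ℝ (Fin d)))) ⊆
        hellingerBall R k d ε (∑ j, w₀ j • Measure.dirac (μ₀ j)) ∧
      (C.card : ℝ) ≤ (1 + 4 * momentConst R k * ((k + k : ℕ) * momentBound R ε k) / δ) ^
        ((k + k) * d + (k + k) ^ (k + k)) ∧
      ∀ P ∈ hellingerBall R k d ε (∑ j, w₀ j • Measure.dirac (μ₀ j)),
        ∃ Q ∈ C, hellinger P Q < δ := by
  classical
  set A := hellingerBall R k d ε (∑ j, w₀ j • Measure.dirac (μ₀ j)) with hA
  have hex : ∀ P, ∃ w μ b, P ∈ A → IsFramed R ε w₀ μ₀ P w μ b := by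
    intro P
    by_cases hP : P ∈ A
    · obtain ⟨w, μ, b, h⟩ := exists_isFramed hP
      exact ⟨w, μ, b, fun _ => h⟩
    · exact ⟨0, 0, 0, fun h => absurd h hP⟩
  choose w μ b hf using hex
  have hB := momentBound_pos R hε k
  have hL : 0 < momentConst R k := by unfold momentConst; positivity
  set β : ℝ := (k + k : ℕ) * momentBound R ε k with hβ
  have hn1 : (1 : ℝ) ≤ (k + k : ℕ) := by exact_mod_cast (by omega : 1 ≤ k + k)
  have hBβ : momentBound R ε k ≤ β := le_mul_of_one_le_left hB.le hn1
  have hβ0 : 0 < β := hB.trans_le hBβ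
  -- Scaling the frame by `β`, of order `ε`, puts both components in one ball of radius `β` and
  -- makes each term of `hellinger_le_framed` at most `‖Φ P - Φ Q‖`; hence the factor `2` in `η`
  -- below.
  let Φ : Measure (EuclideanSpace ℝ (Fin d)) →
      (Fin (k + k) → EuclideanSpace ℝ (Fin d)) × momentSpace (k + k) :=
    fun P => (β • b P, framedMoments w₀ μ₀ (w P) (μ P) (b P))
  have hΦ : ∀ P ∈ A, ‖Φ P‖ ≤ β := by
    intro P hP
    refine norm_prod_le_iff.2 ⟨?_, (norm_framedMoments_le hR hε hw₀ hμ₀ (hf P hP)).trans hBβ⟩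
    rw [norm_smul, Real.norm_of_nonneg hβ0.le]
    refine mul_le_of_le_one_right hβ0.le ?_
    exact (pi_norm_le_iff_of_nonneg zero_le_one).2 (hf P hP).frame_norm_le
  obtain ⟨C, hCA, hcard, hcov⟩ := exists_finset_cover A Φ
    (η := δ / (2 * momentConst R k)) (by positivity) hβ0.le hΦ
  refine ⟨C, hCA, hcard.trans ?_, fun P hP => ?_⟩
  · have h1 : 2 * β / (δ / (2 * momentConst R k)) = 4 * momentConst R k * β / δ := by
      field_simp; ring
    rw [h1]
    refine pow_le_pow_right₀ (le_add_of_nonneg_right (by positivity)) ?_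
    rw [Module.finrank_prod, Module.finrank_pi_fintype]
    simp only [finrank_euclideanSpace, Fintype.card_fin, Finset.sum_const, Finset.card_univ,
      smul_eq_mul]
    exact Nat.add_le_add_left (finrank_momentSpace_le _) _
  · obtain ⟨Q, hQ, hPQ⟩ := hcov P hP
    refine ⟨Q, hQ, ?_⟩
    have h := hellinger_le_framed hR hε hw₀ hμ₀ (hf P hP) (hf Q (hCA hQ))
    have h1 : ‖framedMoments w₀ μ₀ (w P) (μ P) (b P) - framedMoments w₀ μ₀ (w Q) (μ Q) (b Q)‖ ≤
        ‖Φ P - Φ Q‖ := norm_snd_le (Φ P - Φ Q)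
    have h2 : momentBound R ε k * ((k + k : ℕ) * ‖b P - b Q‖) ≤ ‖Φ P - Φ Q‖ := by
      have := norm_fst_le (Φ P - Φ Q)
      simp only [Φ, Prod.fst_sub] at this
      rw [← smul_sub, norm_smul, Real.norm_of_nonneg hβ0.le] at this
      calc _ = β * ‖b P - b Q‖ := by rw [hβ]; ring
        _ ≤ _ := this
    rw [lt_div_iff₀ (by positivity)] at hPQ
    calc hellinger P Q ≤ momentConst R k * (‖Φ P - Φ Q‖ + ‖Φ P - Φ Q‖) := by
          refine h.trans ?_
          gcongr
      _ = ‖Φ P - Φ Q‖ * (2 * momentConst R k) := by ring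
      _ < δ := hPQ

end Covering

/-! ### Numerical estimates -/

section Numerics

/-- With `n = 2k`, the chain `n · n! ≤ n^(n+1) ≤ exp(n(n+1))` ends at `4k² + 2k ≤ 6k²`. Order `k²`
is all that the target exponent requires. -/
theorem mul_factorial_le_exp {k : ℕ} (hk : 1 ≤ k) :
    ((k + k : ℕ) : ℝ) * (k + k).factorial ≤ Real.exp (6 * (k : ℝ) ^ 2) := by
  set n := k + k with hn
  have hk' : (1 : ℝ) ≤ k := by exact_mod_cast hk
  have hnk : (n : ℝ) = 2 * k := by rw [hn]; push_cast; ring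
  have h1 : (n : ℝ) ≤ Real.exp n := by linarith [Real.add_one_le_exp (n : ℝ)]
  calc (n : ℝ) * n.factorial ≤ n * (n : ℝ) ^ n := by
        gcongr
        exact_mod_cast Nat.factorial_le_pow n
    _ = (n : ℝ) ^ (n + 1) := by ring
    _ ≤ Real.exp n ^ (n + 1) := by gcongr
    _ = Real.exp ((n + 1 : ℕ) * n) := by rw [← Real.exp_nat_mul]
    _ ≤ _ := by
        apply Real.exp_le_exp.2
        push_cast
        rw [hnk]
        nlinarith

/-- The exponent per dimension in the covering bound, up to the factor `k²`. -/
def entropyConst (R : ℝ) : ℝ :=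
  Real.log (8 * Real.exp (R ^ 2 / 2) * laplaceConst R) +
    2 * Real.log (2 * Real.exp ((2 * (1 + 5 * R)) ^ 2 / 2)) + 6

theorem one_le_laplaceConst {R : ℝ} (hR : 0 ≤ R) : 1 ≤ laplaceConst R := by
  unfold laplaceConst
  have h1 : (1 : ℝ) ≤ Real.exp 128 := Real.one_le_exp (by norm_num)
  have h2 : 1 ≤ Real.exp (32 * R + 512) := Real.one_le_exp (by positivity)
  have h3 : 1 ≤ √(2 * Real.exp (32 * R + 512)) := Real.one_le_sqrt.2 (by linarith)
  nlinarith

theorem entropyConst_log_nonneg {R : ℝ} (hR : 0 ≤ R) :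
    0 ≤ Real.log (8 * Real.exp (R ^ 2 / 2) * laplaceConst R) ∧
      0 ≤ Real.log (2 * Real.exp ((2 * (1 + 5 * R)) ^ 2 / 2)) := by
  have h1 : 1 ≤ Real.exp (R ^ 2 / 2) := Real.one_le_exp (by positivity)
  have h2 : 1 ≤ Real.exp ((2 * (1 + 5 * R)) ^ 2 / 2) := Real.one_le_exp (by positivity)
  have h3 := one_le_laplaceConst hR
  exact ⟨Real.log_nonneg (by nlinarith), Real.log_nonneg (by linarith)⟩

theorem one_add_const_le_exp {R : ℝ} (hR : 0 ≤ R) {k : ℕ} (hk : 1 ≤ k) :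
    1 + 4 * momentConst R k * ((k + k : ℕ) * ((k + k).factorial * laplaceConst R)) ≤
      Real.exp (entropyConst R * (k : ℝ) ^ 2) := by
  have hk' : (1 : ℝ) ≤ k := by exact_mod_cast hk
  have hkk : (k : ℝ) ≤ (k : ℝ) ^ 2 := by nlinarith
  have hL := one_le_laplaceConst hR
  obtain ⟨hl1, hl2⟩ := entropyConst_log_nonneg hR
  set c₀ := 8 * Real.exp (R ^ 2 / 2) * laplaceConst R with hc₀
  set c₁ := 2 * Real.exp ((2 * (1 + 5 * R)) ^ 2 / 2) with hc₁
  have hc₀pos : 0 < c₀ := by positivity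
  have hc₁pos : 0 < c₁ := by positivity
  have hnf : (1 : ℝ) ≤ (k + k : ℕ) * (k + k).factorial := by
    have h : 1 ≤ (k + k) * (k + k).factorial :=
      Nat.mul_pos (by omega) (Nat.factorial_pos _)
    exact_mod_cast h
  have hc₁one : 1 ≤ c₁ := by
    have : 1 ≤ Real.exp ((2 * (1 + 5 * R)) ^ 2 / 2) := Real.one_le_exp (by positivity)
    linarith
  have he1 : 1 ≤ Real.exp (R ^ 2 / 2) := Real.one_le_exp (by positivity)
  set X := 4 * momentConst R k * ((k + k : ℕ) * ((k + k).factorial * laplaceConst R)) with hX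
  have hXeq : 2 * X = c₀ * c₁ ^ (k + k) * ((k + k : ℕ) * (k + k).factorial) := by
    rw [hX, hc₀, momentConst, ← hc₁]; ring
  have hX1 : 2 ≤ 2 * X := by
    rw [hXeq]
    have h8 : 2 ≤ c₀ := by rw [hc₀]; nlinarith
    calc (2 : ℝ) = 2 * 1 * 1 := by norm_num
      _ ≤ _ := by gcongr; exact one_le_pow₀ hc₁one
  calc 1 + X ≤ 2 * X := by linarith
    _ = _ := hXeq
    _ ≤ Real.exp (Real.log c₀) * Real.exp (Real.log c₁) ^ (k + k) *
        Real.exp (6 * (k : ℝ) ^ 2) := by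
        rw [Real.exp_log hc₀pos, Real.exp_log hc₁pos]
        gcongr
        exact mul_factorial_le_exp hk
    _ = Real.exp (Real.log c₀ + (k + k : ℕ) * Real.log c₁ + 6 * (k : ℝ) ^ 2) := by
        rw [← Real.exp_nat_mul, ← Real.exp_add, ← Real.exp_add]
    _ ≤ _ := by
        apply Real.exp_le_exp.2
        rw [entropyConst, ← hc₀, ← hc₁]
        push_cast
        nlinarith [mul_le_mul_of_nonneg_left hkk hl2,
          mul_le_mul_of_nonneg_left (hk'.trans hkk) hl1]

/-- Since `x ≥ 2`, constants of size `exp(κk²)` are absorbed into powers of `x`. -/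
theorem covering_bound_le_rpow {A κ x : ℝ} (hA : 0 ≤ A) (hκ : 0 ≤ κ) (hx : 2 ≤ x) {k d : ℕ}
    (hk : 1 ≤ k) (hAκ : 1 + A ≤ Real.exp (κ * (k : ℝ) ^ 2)) :
    (1 + A * x) ^ ((k + k) * d + (k + k) ^ (k + k)) ≤
      x ^ (2 * (1 + 2 * κ) * ((d : ℝ) * (k : ℝ) ^ 4 + (2 * (k : ℝ)) ^ (2 * k + 2))) := by
  have hk' : (1 : ℝ) ≤ k := by exact_mod_cast hk
  have hx0 : 0 < x := by linarith
  have hkk : (1 : ℝ) ≤ (k : ℝ) ^ 2 := one_le_pow₀ hk'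
  have hexp : Real.exp (κ * (k : ℝ) ^ 2) ≤ x ^ (2 * κ * (k : ℝ) ^ 2) := by
    rw [Real.rpow_def_of_pos hx0]
    apply Real.exp_le_exp.2
    -- This is the source of the factor `2κ` in the exponent.
    have hlog : 1 / 2 ≤ Real.log x := by
      have := Real.log_le_log (by norm_num) hx
      linarith [Real.log_two_gt_d9]
    have : 0 ≤ κ * (k : ℝ) ^ 2 := by positivity
    nlinarith
  have hbase : 1 + A * x ≤ x ^ ((1 + 2 * κ) * (k : ℝ) ^ 2) := by
    calc 1 + A * x ≤ x * (1 + A) := by nlinarith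
      _ ≤ x ^ (1 : ℝ) * x ^ (2 * κ * (k : ℝ) ^ 2) := by
          rw [Real.rpow_one]
          exact mul_le_mul_of_nonneg_left (hAκ.trans hexp) hx0.le
      _ = x ^ (1 + 2 * κ * (k : ℝ) ^ 2) := by rw [← Real.rpow_add hx0]
      _ ≤ _ := by
          apply Real.rpow_le_rpow_of_exponent_le (by linarith)
          nlinarith
  calc _ ≤ (x ^ ((1 + 2 * κ) * (k : ℝ) ^ 2)) ^ ((k + k) * d + (k + k) ^ (k + k)) := by
        gcongr
    _ = x ^ ((1 + 2 * κ) * (k : ℝ) ^ 2 * (((k + k) * d + (k + k) ^ (k + k) : ℕ) : ℝ)) := by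
        rw [← Real.rpow_natCast, ← Real.rpow_mul hx0.le]
    _ ≤ _ := by
        apply Real.rpow_le_rpow_of_exponent_le (by linarith)
        have hd : (0 : ℝ) ≤ d := Nat.cast_nonneg d
        -- The frame part contributes `2dk³`, which is below `2dk⁴`; the moment part contributes
        -- `k²(2k)^(2k)`, which is below `(2k)^(2k+2)`.
        have h1 : (k : ℝ) ^ 2 * (((k + k) * d + (k + k) ^ (k + k) : ℕ) : ℝ) ≤
            2 * ((d : ℝ) * (k : ℝ) ^ 4 + (2 * (k : ℝ)) ^ (2 * k + 2)) := by
          push_cast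
          rw [← two_mul (k : ℝ), ← two_mul k, pow_add (2 * (k : ℝ)) (2 * k) 2]
          have h3 : (k : ℝ) ^ 3 ≤ (k : ℝ) ^ 4 := pow_le_pow_right₀ hk' (by norm_num)
          have h4 : 0 ≤ (2 * (k : ℝ)) ^ (2 * k) := by positivity
          have h5 := mul_le_mul_of_nonneg_left h3 hd
          have h6 : 0 ≤ (2 * (k : ℝ)) ^ (2 * k) * (k : ℝ) ^ 2 := by positivity
          nlinarith
        calc _ = (1 + 2 * κ) *
              ((k : ℝ) ^ 2 * (((k + k) * d + (k + k) ^ (k + k) : ℕ) : ℝ)) := by ring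
          _ ≤ (1 + 2 * κ) * (2 * ((d : ℝ) * (k : ℝ) ^ 4 + (2 * (k : ℝ)) ^ (2 * k + 2))) := by
              gcongr
          _ = _ := by ring

end Numerics

end GaussianMixture

end

/-! ### Assembly of the covering bound. -/

theorem mainTheorem4 (R : ℝ) :
    ∃ c : ℝ, 0 < c ∧
      ∀ (k d : ℕ) (Γ₀ : Measure (EuclideanSpace ℝ (Fin d))),
        Γ₀ ∈ GaussianMixture.mixingDistributions R k d →
        ∀ ε δ : ℝ, 0 < δ → δ ≤ ε / 2 →
          ((GaussianMixture.coveringNumber δ (GaussianMixture.hellingerBall R k d ε Γ₀)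
              GaussianMixture.hellinger : ℕ∞) : ℝ≥0∞) ≤
            ENNReal.ofReal
              ((ε / δ) ^ (c * ((d : ℝ) * (k : ℝ) ^ 4 + (2 * (k : ℝ)) ^ (2 * k + 2)))) := by
  open GaussianMixture in
  -- For negative `R` there is no admissible `Γ₀`, so any constant serves. The case `k = 0` is
  -- excluded because an empty sum of weights is not `1`.
  rcases lt_or_ge R 0 with hR | hR
  · refine ⟨1, one_pos, fun k d Γ₀ hΓ₀ => ?_⟩
    obtain ⟨w₀, μ₀, hw₀, hμ₀, -⟩ := hΓ₀
    rcases Nat.eq_zero_or_pos k with rfl | hk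
    · simp at hw₀
    · linarith [hμ₀ ⟨0, hk⟩, norm_nonneg (μ₀ ⟨0, hk⟩)]
  obtain ⟨hl1, hl2⟩ := entropyConst_log_nonneg hR
  have hκ : 0 ≤ entropyConst R := by unfold entropyConst; positivity
  refine ⟨2 * (1 + 2 * entropyConst R), by positivity, ?_⟩
  rintro k d Γ₀ ⟨w₀, μ₀, hw₀, hμ₀, rfl⟩ ε δ hδ hδε
  have hk : 1 ≤ k := by
    rcases Nat.eq_zero_or_pos k with rfl | hk
    · simp at hw₀
    · exact hk
  have hε : 0 < ε := by linarith
  obtain ⟨C, hCA, hcard, hcov⟩ := exists_cover_hellingerBall (d := d) hR hε hδ hk hw₀ hμ₀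
  have hN : coveringNumber δ (hellingerBall R k d ε (∑ j, w₀ j • Measure.dirac (μ₀ j)))
      hellinger ≤ (C.card : ℕ∞) := by
    rw [← Set.encard_coe_eq_coe_finsetCard]
    exact iInf₂_le_of_le _ hCA (iInf_le_of_le (fun P hP => hcov P hP) le_rfl)
  have hL := laplaceConst_pos R
  have hM : 0 < momentConst R k := by unfold momentConst; positivity
  have hbound := covering_bound_le_rpow (d := d)
    (A := 4 * momentConst R k * ((k + k : ℕ) * ((k + k).factorial * laplaceConst R)))
    (by positivity) hκ ((le_div_iff₀ hδ).2 (by linarith) : 2 ≤ ε / δ) hk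
    (one_add_const_le_exp hR hk)
  have heq : 4 * momentConst R k * ((k + k : ℕ) * momentBound R ε k) / δ =
      4 * momentConst R k * ((k + k : ℕ) * ((k + k).factorial * laplaceConst R)) * (ε / δ) := by
    rw [momentBound]; ring
  rw [heq] at hcard
  calc ((coveringNumber δ (hellingerBall R k d ε (∑ j, w₀ j • Measure.dirac (μ₀ j)))
        hellinger : ℕ∞) : ℝ≥0∞) ≤ ((C.card : ℕ∞) : ℝ≥0∞) := by exact_mod_cast hN
    _ = ENNReal.ofReal (C.card : ℝ) := by simp
    _ ≤ _ := ENNReal.ofReal_le_ofReal (hcard.trans hbound)
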